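/- Let $[n]=\{1,\dots,n\}$ and $\vec r=(r_1<\dots<r_s)$ with $1\le r_i<n$. An $(\vec r,n)$-flag matroid is a sequence $\vec Q=(Q_1,\dots,Q_s)$ of matroids on $[n]$, identified with their sets of bases, such that $Q_i$ has rank $r_i$ and, for $i\le j$, every flat of $Q_i$ is a flat of $Q_j$. Its polytope is $$\Delta(\vec Q)=\operatorname{conv}\{e_{\lambda_1}+\dots+e_{\lambda_s} : \lambda_i\in Q_i\}\subset\mathbb R^n,$$ where $e_\lambda=\sum_{k\in\lambda}e_k$. For flag matroids $\vec P,\vec Q$ of the same type write $\vec P\le\vec Q$ if there is $v\in\mathbb R^n$ such that, for every $i$, $P_i$ is the set of those $\lambda\in Q_i$ for which $\sum_{k\in\lambda}v_k$ is minimal; such a $\vec P$ is internal if $\Delta(\vec P)$ meets the relative interior of the polytope $\Delta(\vec r,n)$ of the uniform flag matroid (for $\vec r=(1,\dots,n-1)$ this is the permutahedron $\Pi_n$). The flag variety $\mathrm{Fl}(\vec r,n)$ of flags $F_1\subset\dots\subset F_s\subset\mathbb C^n$ with $\dim F_i=r_i$ is embedded in $\mathbb P(\wedge^{r_1}\mathbb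 C^n)\times\dots\times\mathbb P(\wedge^{r_s}\mathbb C^n)$ by Plücker coordinates $p_\lambda$; let $I_{\vec r,n}$ be its multihomogeneous ideal. The stratum $\mathrm{Fl}(\vec Q)$ is the scheme-theoretic intersection of $\mathrm{Fl}(\vec r,n)$ with the locus where $p_\lambda\ne0$ for $\lambda\in Q_i$ and $p_\lambda=0$ for $\lambda\notin Q_i$ ($|\lambda|=r_i$, $i=1,\dots,s$). Explicitly, $\mathrm{Fl}(\vec Q)$ is the spectrum of the ring of $\mathbb G_m^s$-invariants of $R_{\vec Q}=S_{\vec Q}^{-1}B_{\vec Q}/I_{\vec Q}$, where $B_{\vec Q}=\mathbb C[p_\lambda:\lambda\in Q_1\cup\dots\cup Q_s]$, $I_{\vec Q}=(I_{\vec r,n}+\langle p_\lambda:\lambda\notin Q_1\cup\dots\cup Q_s\rangle)\cap B_{\vec Q}$, $S_{\vec Q}$ is the multiplicative set generated by the variables of $B_{\vec Q}$, and the $i$-th factor of $\mathbb G_m^s$ scales the $p_\lambda$ with $|\lambda|=r_i$. If $\vec P\le\vec Q$, the inclusion $B_{\vec P}\subset B_{\vec Q}$ maps $I_{\vec P}$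 into $I_{\vec Q}$ and so induces the face morphism $\varphi_{\vec Q,\vec P}:\mathrm{Fl}(\vec Q)\to\mathrm{Fl}(\vec P)$. **Proposition.** Let $\vec Q$ be a flag matroid of ranks $(1,2,3)$ on $[4]$ with $\dim\Delta(\vec Q)=3$, and let $\vec P\le\vec Q$ be internal. Then the face morphism $\varphi_{\vec Q,\vec P}:\mathrm{Fl}(\vec Q)\to\mathrm{Fl}(\vec P)$ is a smooth and dominant morphism of schemes, and its (nonempty) scheme-theoretic fibers, over all points of the image, are connected. -/

import Mathlib

open AlgebraicGeometry CategoryTheory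

/-- A flag matroid on `[n]` with rank vector `r = (r₁, …, rₛ)`: matroids `Q₁, …, Qₛ` on `[n]` of
ranks `r₁, …, rₛ` such that `Qᵢ` is a quotient of `Qⱼ` for `i ≤ j`, that is, every flat of `Qᵢ`
is a flat of `Qⱼ`. -/
structure FlagMatroid (n : ℕ) {s : ℕ} (r : Fin s → ℕ) where
  /-- the constituents -/
  matroid : Fin s → Matroid (Fin n)
  ground_eq : ∀ i, (matroid i).E = Set.univ
  eRank_eq : ∀ i, (matroid i).eRank = r i
  isFlat_of_le : ∀ i j, i ≤ j → ∀ F : Set (Fin n), (matroid i).IsFlat F → (matroid j).IsFlat F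

/-- The convex hull in `ℝⁿ` of the points `e_{λ₁} + ⋯ + e_{λₛ}` with `λᵢ ∈ B i`, where `e_λ` is the
indicator vector of `λ ⊆ [n]`: the polytope of the Minkowski sum of the point configurations
`λ ↦ e_λ` on `B 1, …, B s`. -/
def minkowskiPolytope {n s : ℕ} (B : Fin s → Set (Finset (Fin n))) : Set (Fin n → ℝ) :=
  convexHull ℝ {p | ∃ l : Fin s → Finset (Fin n), (∀ i, l i ∈ B i) ∧
    p = ∑ i, (fun k => if k ∈ l i then (1 : ℝ) else 0)}

/-- The polytope `Δ(r, n)`, the sum of the hypersimplices `Δ(rᵢ, n)`, which is the polytope of the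
uniform flag matroid. For `r = (1, …, n - 1)` it is the permutahedron. -/
def uniformFlagPolytope (n : ℕ) {s : ℕ} (r : Fin s → ℕ) : Set (Fin n → ℝ) :=
  minkowskiPolytope fun i => {l : Finset (Fin n) | l.card = r i}

/-- Indices of the Plücker coordinates on `ℙ(∧^{r₁} ℂⁿ) × ⋯ × ℙ(∧^{rₛ} ℂⁿ)`. -/
abbrev PluckerIndex (n : ℕ) {s : ℕ} (r : Fin s → ℕ) : Type :=
  {x : Fin s × Finset (Fin n) // x.2.card = r x.1}

/-- The minor of `A` on its first `|l|` rows and the columns in `l`, i.e. the Plücker coordinate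
indexed by `l` of the span of the first `|l|` rows of `A`. -/
noncomputable def initialMinor {n : ℕ} (A : Matrix (Fin n) (Fin n) ℂ) (l : Finset (Fin n)) : ℂ :=
  (A.submatrix (Fin.castLE (card_finset_fin_le l)) (l.orderEmbOfFin rfl)).det

/-- The multicone over the flag variety `Fl(r, n)`: all systems of multihomogeneous Plücker
coordinates of flags `F₁ ⊆ ⋯ ⊆ Fₛ ⊆ ℂⁿ` with `dim Fᵢ = rᵢ`. The flag is given by an invertible
matrix whose first `rᵢ` rows span `Fᵢ`, and `c i` is the choice of the homogeneous scalar. -/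
def flagCone (n : ℕ) {s : ℕ} (r : Fin s → ℕ) : Set (PluckerIndex n r → ℂ) :=
  {p | ∃ A : Matrix (Fin n) (Fin n) ℂ, A.det ≠ 0 ∧ ∃ c : Fin s → ℂˣ,
    ∀ x : PluckerIndex n r, p x = c x.1.1 * initialMinor A x.1.2}

/-- The multihomogeneous ideal of the flag variety `Fl(r, n)`. -/
noncomputable def flagIdeal (n : ℕ) {s : ℕ} (r : Fin s → ℕ) :
    Ideal (MvPolynomial (PluckerIndex n r) ℂ) :=
  MvPolynomial.vanishingIdeal ℂ (flagCone n r)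

/-- The rescaling `p_x ↦ a_x p_x` of the variables of a polynomial ring. -/
noncomputable def rescale {σ : Type} (a : σ → ℂ) : MvPolynomial σ ℂ →ₐ[ℂ] MvPolynomial σ ℂ :=
  MvPolynomial.aeval fun x => MvPolynomial.C (a x) * MvPolynomial.X x

theorem rescale_X {σ : Type} (a : σ → ℂ) (x : σ) :
    rescale a (MvPolynomial.X x) = MvPolynomial.C (a x) * MvPolynomial.X x := by
  simp [rescale]

theorem rescale_monomial {σ : Type} (a : σ → ℂ) (m : σ →₀ ℕ) (k : ℂ) :
    rescale a (MvPolynomial.monomial m k) =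
      MvPolynomial.C (m.prod fun x e => a x ^ e) * MvPolynomial.monomial m k := by
  rw [rescale, MvPolynomial.aeval_monomial, MvPolynomial.monomial_eq]
  simp only [mul_pow, Finsupp.prod_mul, MvPolynomial.algebraMap_eq]
  simp only [Finsupp.prod, map_prod, map_pow]
  ring

theorem aeval_rescale {σ : Type} (a y : σ → ℂ) (f : MvPolynomial σ ℂ) :
    MvPolynomial.aeval y (rescale a f) = MvPolynomial.aeval (fun x => a x * y x) f := by
  rw [rescale, ← AlgHom.comp_apply]
  congr 1
  ext x
  simp

theorem initialMinor_mul_diagonal {n : ℕ} (A : Matrix (Fin n) (Fin n) ℂ) (h : Fin n → ℂ)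
    (l : Finset (Fin n)) :
    initialMinor (A * Matrix.diagonal h) l = (∏ j ∈ l, h j) * initialMinor A l := by
  have h1 : (A * Matrix.diagonal h).submatrix (Fin.castLE (card_finset_fin_le l))
      (l.orderEmbOfFin rfl) =
      Matrix.of fun i j => h (l.orderEmbOfFin rfl j) *
        (A.submatrix (Fin.castLE (card_finset_fin_le l)) (l.orderEmbOfFin rfl)) i j := by
    ext i j
    simp [Matrix.mul_diagonal, mul_comm]
  have h2 : ∏ j ∈ l, h j = ∏ i, h (l.orderEmbOfFin rfl i) := by
    conv_lhs => rw [← Finset.image_orderEmbOfFin_univ l rfl]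
    rw [Finset.prod_image]
    exact fun _ _ _ _ e => (l.orderEmbOfFin rfl).injective e
  rw [initialMinor, h1, Matrix.det_mul_row, h2, initialMinor]

/-- The ideal of the flag variety is stable under the tori scaling the factors and the columns. -/
theorem rescale_mem_flagIdeal {n s : ℕ} {r : Fin s → ℕ} (c : Fin s → ℂˣ) (h : Fin n → ℂˣ)
    {f : MvPolynomial (PluckerIndex n r) ℂ} (hf : f ∈ flagIdeal n r) :
    rescale (fun x => (c x.1.1 : ℂ) * ∏ j ∈ x.1.2, (h j : ℂ)) f ∈ flagIdeal n r := by
  rintro y ⟨A, hA, d, hy⟩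
  rw [aeval_rescale]
  apply hf
  refine ⟨A * Matrix.diagonal fun j => (h j : ℂ), ?_, c * d, fun x => ?_⟩
  · rw [Matrix.det_mul, Matrix.det_diagonal]
    exact mul_ne_zero hA (Finset.prod_ne_zero_iff.mpr fun j _ => (h j).ne_zero)
  · beta_reduce
    rw [initialMinor_mul_diagonal, hy]
    simp only [Pi.mul_apply, Units.val_mul]
    ring

/-- If a linear combination of an eigenvector of eigenvalue `1` and of eigenvectors of other
eigenvalues lies in a stable subspace, then so does the first eigenvector. -/
theorem mem_of_sub_sum_mem {V ι : Type} [AddCommGroup V] [Module ℂ V] (K : Submodule ℂ V)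
    (T : V →ₗ[ℂ] V) (hT : ∀ v ∈ K, T v ∈ K) (f : V) (hf : T f = f) (e : ι → ℂ) (S : Finset ι)
    (he : ∀ m ∈ S, e m ≠ 1) : ∀ g : ι → V, (∀ m ∈ S, T (g m) = e m • g m) →
      f - ∑ m ∈ S, g m ∈ K → f ∈ K := by
  classical
  induction S using Finset.induction_on with
  | empty => intro g _ h; simpa using h
  | insert a S ha ih =>
    intro g hg h
    have hne : (1 : ℂ) - e a ≠ 0 := sub_ne_zero.mpr (he a (by simp)).symm
    refine ih (fun m hm => he m (by simp [hm]))
      (fun m => ((1 - e a)⁻¹ * (e m - e a)) • g m) (fun m hm => ?_) ?_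
    · rw [map_smul, hg m (by simp [hm]), smul_comm]
    · have h1 := K.smul_mem (1 - e a)⁻¹ (K.sub_mem (hT _ h) (K.smul_mem (e a) h))
      have h2 : f - ∑ m ∈ S, ((1 - e a)⁻¹ * (e m - e a)) • g m =
          (1 - e a)⁻¹ • (T (f - ∑ m ∈ insert a S, g m) - e a • (f - ∑ m ∈ insert a S, g m)) := by
        have h3 : T (f - ∑ m ∈ insert a S, g m) - e a • (f - ∑ m ∈ insert a S, g m) =
            (1 - e a) • f - ∑ m ∈ S, (e m - e a) • g m := by
          rw [map_sub, hf, map_sum, Finset.sum_congr rfl hg, Finset.sum_insert ha,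
            Finset.sum_insert ha]
          simp only [sub_smul, one_smul, smul_sub, smul_add, Finset.sum_sub_distrib,
            Finset.smul_sum]
          abel
        rw [h3, smul_sub, smul_smul, inv_mul_cancel₀ hne, one_smul, Finset.smul_sum]
        simp only [smul_smul]
      rw [h2]
      exact h1

namespace FlagMatroid

variable {n s : ℕ} {r : Fin s → ℕ}

/-- The set of bases of the `i`-th constituent. -/
def bases (Q : FlagMatroid n r) (i : Fin s) : Set (Finset (Fin n)) :=
  {b | (Q.matroid i).IsBase (b : Set (Fin n))}

theorem card_of_mem_bases (Q : FlagMatroid n r) {i : Fin s} {b : Finset (Fin n)}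
    (hb : b ∈ Q.bases i) : b.card = r i := by
  have h := Matroid.IsBase.encard_eq_eRank hb
  rw [Q.eRank_eq, Set.encard_coe_eq_coe_finsetCard] at h
  exact_mod_cast h

theorem bases_nonempty (Q : FlagMatroid n r) (i : Fin s) : ∃ b, b ∈ Q.bases i := by
  obtain ⟨B, hB⟩ := (Q.matroid i).exists_isBase
  exact ⟨(Set.toFinite B).toFinset, by simpa [bases] using hB⟩

/-- The flag matroid polytope `Δ(Q)`. -/
def polytope (Q : FlagMatroid n r) : Set (Fin n → ℝ) :=
  minkowskiPolytope Q.bases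

/-- The dimension of the flag matroid polytope. -/
noncomputable def polytopeDim (Q : FlagMatroid n r) : ℕ :=
  Module.finrank ℝ (vectorSpan ℝ Q.polytope)

/-- The face order `P ≤ Q`: there is a weight vector `v` such that, for each `i`, the bases of `Pᵢ`
are the bases of `Qᵢ` of minimal `v`-weight. -/
def IsFace (P Q : FlagMatroid n r) : Prop :=
  ∃ v : Fin n → ℝ, ∀ i, P.bases i =
    {b | b ∈ Q.bases i ∧ ∀ c ∈ Q.bases i, ∑ j ∈ b, v j ≤ ∑ j ∈ c, v j}

/-- The flag matroid `P` is internal if its polytope meets the relative interior of `Δ(r, n)`. -/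
def IsInternal (P : FlagMatroid n r) : Prop :=
  (P.polytope ∩ intrinsicInterior ℝ (uniformFlagPolytope n r)).Nonempty

/-- Indices of the Plücker coordinates that do not vanish on the stratum of `Q`. -/
abbrev BasisIndex (Q : FlagMatroid n r) : Type :=
  {x : Fin s × Finset (Fin n) // x.2 ∈ Q.bases x.1}

/-- The inclusion of the bases of `Q` into all Plücker indices. -/
def basisIncl (Q : FlagMatroid n r) (b : Q.BasisIndex) : PluckerIndex n r :=
  ⟨b.1, Q.card_of_mem_bases b.2⟩

/-- The ideal `I_{r,n} + ⟨p_λ : λ not a basis of Q⟩`. -/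
noncomputable def bigIdeal (Q : FlagMatroid n r) : Ideal (MvPolynomial (PluckerIndex n r) ℂ) :=
  flagIdeal n r ⊔ Ideal.span (MvPolynomial.X '' {x | x.1.2 ∉ Q.bases x.1.1})

/-- The ring `B_Q = ℂ[p_λ : λ ∈ Q₁] ⊗ ⋯ ⊗ ℂ[p_λ : λ ∈ Qₛ]`. -/
abbrev BRing (Q : FlagMatroid n r) : Type := MvPolynomial Q.BasisIndex ℂ

/-- The ideal `I_Q = (I_{r,n} + ⟨p_λ : λ not a basis of Q⟩) ∩ B_Q`. -/
noncomputable def ideal (Q : FlagMatroid n r) : Ideal Q.BRing :=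
  Q.bigIdeal.comap (MvPolynomial.rename Q.basisIncl)

/-- The image in `B_Q / I_Q` of the multiplicative set `S_Q` generated by the variables of `B_Q`. -/
noncomputable def SMonoid (Q : FlagMatroid n r) : Submonoid (Q.BRing ⧸ Q.ideal) :=
  Submonoid.closure (Set.range fun b => Ideal.Quotient.mk Q.ideal (MvPolynomial.X b))

/-- The ring `R_Q = S_Q⁻¹ B_Q / I_Q`. -/
def RRing (Q : FlagMatroid n r) : Type := Localization Q.SMonoid

noncomputable instance (Q : FlagMatroid n r) : CommRing Q.RRing :=
  inferInstanceAs (CommRing (Localization Q.SMonoid))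

noncomputable instance (Q : FlagMatroid n r) : Algebra (Q.BRing ⧸ Q.ideal) Q.RRing :=
  inferInstanceAs (Algebra (Q.BRing ⧸ Q.ideal) (Localization Q.SMonoid))

noncomputable instance (Q : FlagMatroid n r) : Algebra ℂ Q.RRing :=
  inferInstanceAs (Algebra ℂ (Localization Q.SMonoid))

instance (Q : FlagMatroid n r) : IsScalarTower ℂ (Q.BRing ⧸ Q.ideal) Q.RRing :=
  inferInstanceAs (IsScalarTower ℂ (Q.BRing ⧸ Q.ideal) (Localization Q.SMonoid))

instance (Q : FlagMatroid n r) : IsLocalization Q.SMonoid Q.RRing :=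
  inferInstanceAs (IsLocalization Q.SMonoid (Localization Q.SMonoid))

/-- The canonical map `B_Q → R_Q`. -/
noncomputable def toRRing (Q : FlagMatroid n r) : Q.BRing →ₐ[ℂ] Q.RRing :=
  (IsScalarTower.toAlgHom ℂ (Q.BRing ⧸ Q.ideal) Q.RRing).comp (Ideal.Quotient.mkₐ ℂ Q.ideal)

theorem toRRing_eq_zero (Q : FlagMatroid n r) {f : Q.BRing} (hf : f ∈ Q.ideal) :
    Q.toRRing f = 0 := by
  have : Ideal.Quotient.mkₐ ℂ Q.ideal f = 0 := Ideal.Quotient.eq_zero_iff_mem.mpr hf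
  rw [toRRing, AlgHom.comp_apply, this, map_zero]

theorem isUnit_toRRing_X (Q : FlagMatroid n r) (b : Q.BasisIndex) :
    IsUnit (Q.toRRing (MvPolynomial.X b)) :=
  IsLocalization.map_units Q.RRing
    (⟨_, Submonoid.subset_closure ⟨b, rfl⟩⟩ : Q.SMonoid)

theorem algHom_ext (Q : FlagMatroid n r) {A : Type} [CommRing A] [Algebra ℂ A]
    {f g : Q.RRing →ₐ[ℂ] A}
    (h : ∀ b, f (Q.toRRing (MvPolynomial.X b)) = g (Q.toRRing (MvPolynomial.X b))) : f = g := by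
  apply IsLocalization.algHom_ext Q.SMonoid
  apply Ideal.Quotient.algHom_ext
  apply MvPolynomial.algHom_ext
  exact h

/-- The homomorphism `R_Q → A` induced by a homomorphism `B_Q → A` that kills `I_Q` and sends the
variables to units. -/
noncomputable def liftR (Q : FlagMatroid n r) {A : Type} [CommRing A] [Algebra ℂ A]
    (φ : Q.BRing →ₐ[ℂ] A) (h0 : ∀ f ∈ Q.ideal, φ f = 0)
    (hu : ∀ b, IsUnit (φ (MvPolynomial.X b))) : Q.RRing →ₐ[ℂ] A :=
  IsLocalization.liftAlgHom (M := Q.SMonoid) (f := Ideal.Quotient.liftₐ Q.ideal φ h0) (by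
    rintro ⟨y, hy⟩
    have : Q.SMonoid ≤ (IsUnit.submonoid A).comap (Ideal.Quotient.liftₐ Q.ideal φ h0) := by
      rw [SMonoid, Submonoid.closure_le]
      rintro _ ⟨b, rfl⟩
      exact hu b
    exact this hy)

theorem liftR_toRRing (Q : FlagMatroid n r) {A : Type} [CommRing A] [Algebra ℂ A]
    (φ : Q.BRing →ₐ[ℂ] A) (h0 : ∀ f ∈ Q.ideal, φ f = 0)
    (hu : ∀ b, IsUnit (φ (MvPolynomial.X b))) (f : Q.BRing) :
    Q.liftR φ h0 hu (Q.toRRing f) = φ f := by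
  simp only [liftR, toRRing, AlgHom.comp_apply, IsScalarTower.coe_toAlgHom',
    IsLocalization.coe_liftAlgHom, IsLocalization.lift_eq]
  rfl

theorem rescale_mem_bigIdeal (Q : FlagMatroid n r) (c : Fin s → ℂˣ) (h : Fin n → ℂˣ)
    {f : MvPolynomial (PluckerIndex n r) ℂ} (hf : f ∈ Q.bigIdeal) :
    rescale (fun x => (c x.1.1 : ℂ) * ∏ j ∈ x.1.2, (h j : ℂ)) f ∈ Q.bigIdeal := by
  suffices H : Q.bigIdeal ≤ Q.bigIdeal.comap
      (rescale (fun x => (c x.1.1 : ℂ) * ∏ j ∈ x.1.2, (h j : ℂ))) from H hf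
  refine sup_le (fun g hg => ?_) (Ideal.span_le.mpr ?_)
  · exact Ideal.mem_sup_left (rescale_mem_flagIdeal c h hg)
  · rintro _ ⟨x, hx, rfl⟩
    show rescale _ _ ∈ Q.bigIdeal
    rw [rescale_X]
    exact Ideal.mem_sup_right (Ideal.mul_mem_left _ _ (Ideal.subset_span ⟨x, hx, rfl⟩))

theorem rescale_mem_ideal (Q : FlagMatroid n r) (t : Fin s → ℂˣ) {f : Q.BRing}
    (hf : f ∈ Q.ideal) : rescale (fun b => (t b.1.1 : ℂ)) f ∈ Q.ideal := by
  have h := Q.rescale_mem_bigIdeal t 1 hf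
  have e : (rescale (fun x : PluckerIndex n r => (t x.1.1 : ℂ) * ∏ j ∈ x.1.2, (((1 : Fin n → ℂˣ) j
      : ℂˣ) : ℂ))).comp (MvPolynomial.rename Q.basisIncl) =
      (MvPolynomial.rename Q.basisIncl).comp (rescale fun b : Q.BasisIndex => (t b.1.1 : ℂ)) := by
    apply MvPolynomial.algHom_ext
    intro b
    simp [rescale_X, basisIncl]
  show MvPolynomial.rename Q.basisIncl _ ∈ Q.bigIdeal
  rw [← AlgHom.comp_apply, ← e]
  exact h

/-- The action of `t ∈ 𝔾ₘˢ(ℂ) = (ℂˣ)ˢ` on `R_Q`: it multiplies `p_λ` by `tᵢ` for `λ ∈ Qᵢ`. -/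
noncomputable def torusAct (Q : FlagMatroid n r) (t : Fin s → ℂˣ) : Q.RRing →ₐ[ℂ] Q.RRing :=
  Q.liftR (Q.toRRing.comp (rescale fun b => (t b.1.1 : ℂ)))
    (fun _ hf => Q.toRRing_eq_zero (Q.rescale_mem_ideal t hf))
    (fun b => by
      rw [AlgHom.comp_apply, rescale_X, map_mul]
      exact (((t b.1.1).isUnit.map MvPolynomial.C).map Q.toRRing).mul (Q.isUnit_toRRing_X b))

theorem torusAct_X (Q : FlagMatroid n r) (t : Fin s → ℂˣ) (b : Q.BasisIndex) :
    Q.torusAct t (Q.toRRing (MvPolynomial.X b)) =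
      (t b.1.1 : ℂ) • Q.toRRing (MvPolynomial.X b) := by
  refine (Q.liftR_toRRing _ _ _ _).trans ?_
  rw [AlgHom.comp_apply, rescale_X, ← MvPolynomial.smul_eq_C_mul, map_smul]

/-- The coordinate ring of the stratum of `Q`: the subring of `𝔾ₘˢ`-invariants of `R_Q`. -/
noncomputable def coordRing (Q : FlagMatroid n r) : Subalgebra ℂ Q.RRing where
  carrier := {f | ∀ t : Fin s → ℂˣ, Q.torusAct t f = f}
  mul_mem' hf hg t := by rw [map_mul, hf t, hg t]
  add_mem' hf hg t := by rw [map_add, hf t, hg t]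
  algebraMap_mem' k t := (Q.torusAct t).commutes k

/-- The flag matroid stratum `Fl(Q) = Fl(r, n) ∩ (T(Q₁) × ⋯ × T(Qₛ))`, an affine scheme. -/
noncomputable def stratum (Q : FlagMatroid n r) : Scheme.{0} :=
  Spec (CommRingCat.of Q.coordRing)

theorem IsFace.mem_bases {P Q : FlagMatroid n r} (h : P.IsFace Q) {i : Fin s}
    {b : Finset (Fin n)} (hb : b ∈ P.bases i) : b ∈ Q.bases i := by
  obtain ⟨v, hv⟩ := h
  rw [hv i] at hb
  exact hb.1

/-- The inclusion `B_P ⊆ B_Q` for a face `P ≤ Q`. -/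
noncomputable def inclB {P Q : FlagMatroid n r} (h : P.IsFace Q) : P.BRing →ₐ[ℂ] Q.BRing :=
  MvPolynomial.rename fun b => ⟨b.1, h.mem_bases b.2⟩

/-- The inclusion `B_P ⊆ B_Q` maps `I_P` into `I_Q`. -/
theorem inclB_mem_ideal {P Q : FlagMatroid n r} (h : P.IsFace Q) {f : P.BRing}
    (hf : f ∈ P.ideal) : inclB h f ∈ Q.ideal := by
  classical
  obtain ⟨v, hv⟩ := id h
  choose b₀ hb₀ using P.bases_nonempty
  -- `u x` is the excess of the weight of `x` over the minimal weight
  let u : PluckerIndex n r → ℝ := fun x => ∑ j ∈ x.1.2, v j - ∑ j ∈ b₀ x.1.1, v j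
  have hb₀' : ∀ i, b₀ i ∈ Q.bases i ∧ ∀ c ∈ Q.bases i, ∑ j ∈ b₀ i, v j ≤ ∑ j ∈ c, v j :=
    fun i => by simpa [hv i] using hb₀ i
  have hu0 : ∀ x : PluckerIndex n r, x.1.2 ∈ P.bases x.1.1 → u x = 0 := fun x hx => by
    rw [hv] at hx
    exact sub_eq_zero.mpr (le_antisymm (hx.2 _ (hb₀' _).1) ((hb₀' _).2 _ hx.1))
  have hu1 : ∀ x : PluckerIndex n r, x.1.2 ∈ Q.bases x.1.1 → 0 ≤ u x := fun x hx =>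
    sub_nonneg.mpr ((hb₀' _).2 _ hx)
  have hu2 : ∀ x : PluckerIndex n r, x.1.2 ∈ Q.bases x.1.1 → x.1.2 ∉ P.bases x.1.1 → 0 < u x := by
    intro x hx hx'
    refine lt_of_le_of_ne (hu1 x hx) fun h0 => hx' ?_
    rw [hv]
    exact ⟨hx, fun c hc => by
      have := (hb₀' x.1.1).2 c hc
      have h0 := sub_eq_zero.mp h0.symm
      linarith⟩
  let t : ℝ → ℂˣ := fun z => Units.mk0 (Real.exp z : ℂ)
    (Complex.ofReal_ne_zero.mpr (Real.exp_pos z).ne')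
  let a : PluckerIndex n r → ℂ := fun x =>
    (t (-∑ j ∈ b₀ x.1.1, v j) : ℂ) * ∏ j ∈ x.1.2, (t (v j) : ℂ)
  have ha : ∀ x, a x = (Real.exp (u x) : ℂ) := fun x => by
    simp only [a, t, u, Units.val_mk0]
    rw [← Complex.ofReal_prod, ← Real.exp_sum, ← Complex.ofReal_mul, ← Real.exp_add]
    congr 2
    ring
  have hF : MvPolynomial.rename Q.basisIncl (inclB h f) = MvPolynomial.rename P.basisIncl f := by
    rw [inclB, MvPolynomial.rename_rename]
    rfl
  show MvPolynomial.rename Q.basisIncl (inclB h f) ∈ Q.bigIdeal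
  rw [hF]
  have hT1 : rescale a (MvPolynomial.rename P.basisIncl f) = MvPolynomial.rename P.basisIncl f := by
    rw [← AlgHom.comp_apply]
    congr 1
    apply MvPolynomial.algHom_ext
    intro b
    have : a (P.basisIncl b) = 1 := by rw [ha, hu0 _ b.2]; simp
    simp [rescale_X, this]
  have hf' : MvPolynomial.rename P.basisIncl f ∈ P.bigIdeal := hf
  obtain ⟨g, hg, k, hk, hgk⟩ := Submodule.mem_sup.mp hf'
  rw [MvPolynomial.mem_ideal_span_X_image] at hk
  let S := k.support.filter fun m => ∀ x ∈ m.support, x.1.2 ∈ Q.bases x.1.1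
  refine mem_of_sub_sum_mem (Q.bigIdeal.restrictScalars ℂ) (rescale a).toLinearMap
    (fun w hw => Q.rescale_mem_bigIdeal (fun i => t (-∑ j ∈ b₀ i, v j)) (fun j => t (v j)) hw)
    (MvPolynomial.rename P.basisIncl f) hT1 (fun m => m.prod fun x e => a x ^ e) S ?_
    (fun m => MvPolynomial.monomial m (k.coeff m)) ?_ ?_
  · intro m hm
    obtain ⟨hm1, hm2⟩ := Finset.mem_filter.mp hm
    have e1 : (m.prod fun x e => a x ^ e) = (Real.exp (∑ x ∈ m.support, m x * u x) : ℂ) := by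
      rw [Finsupp.prod, Real.exp_sum, Complex.ofReal_prod]
      refine Finset.prod_congr rfl fun x _ => ?_
      rw [ha, Real.exp_nat_mul, Complex.ofReal_pow]
    rw [e1]
    obtain ⟨x, hx, hmx⟩ := hk m hm1
    have hpos : 0 < ∑ x ∈ m.support, (m x : ℝ) * u x :=
      Finset.sum_pos' (fun y hy => mul_nonneg (Nat.cast_nonneg _) (hu1 y (hm2 y hy)))
        ⟨x, Finsupp.mem_support_iff.mpr hmx, mul_pos (Nat.cast_pos.mpr (Nat.pos_of_ne_zero hmx))
          (hu2 x (hm2 x (Finsupp.mem_support_iff.mpr hmx)) hx)⟩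
    have := (Real.one_lt_exp_iff.mpr hpos).ne'
    exact_mod_cast this
  · intro m _
    rw [AlgHom.toLinearMap_apply, rescale_monomial, MvPolynomial.smul_eq_C_mul]
  · have hsplit : k = ∑ m ∈ S, MvPolynomial.monomial m (k.coeff m) +
        ∑ m ∈ k.support.filter (fun m => ¬ ∀ x ∈ m.support, x.1.2 ∈ Q.bases x.1.1),
          MvPolynomial.monomial m (k.coeff m) := by
      rw [Finset.sum_filter_add_sum_filter_not]
      exact k.as_sum
    show _ ∈ Q.bigIdeal
    have : MvPolynomial.rename P.basisIncl f - ∑ m ∈ S, MvPolynomial.monomial m (k.coeff m) =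
        g + ∑ m ∈ k.support.filter (fun m => ¬ ∀ x ∈ m.support, x.1.2 ∈ Q.bases x.1.1),
          MvPolynomial.monomial m (k.coeff m) := by
      rw [← hgk]
      nth_rewrite 1 [hsplit]
      abel
    rw [this]
    refine Q.bigIdeal.add_mem (Ideal.mem_sup_left hg) (Q.bigIdeal.sum_mem fun m hm => ?_)
    refine Ideal.mem_sup_right (MvPolynomial.mem_ideal_span_X_image.mpr fun m' hm' => ?_)
    have hmm : m' = m := by
      simpa using MvPolynomial.support_monomial_subset hm'
    subst hmm
    have := (Finset.mem_filter.mp hm).2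
    push Not at this
    obtain ⟨x, hx, hxQ⟩ := this
    exact ⟨x, hxQ, Finsupp.mem_support_iff.mp hx⟩

/-- The homomorphism `R_P → R_Q` induced by the inclusion `B_P ⊆ B_Q`. -/
noncomputable def faceHomR {P Q : FlagMatroid n r} (h : P.IsFace Q) : P.RRing →ₐ[ℂ] Q.RRing :=
  P.liftR (Q.toRRing.comp (inclB h)) (fun _ hf => Q.toRRing_eq_zero (inclB_mem_ideal h hf))
    (fun b => by
      rw [AlgHom.comp_apply, inclB, MvPolynomial.rename_X]
      exact Q.isUnit_toRRing_X _)

theorem faceHomR_torusAct {P Q : FlagMatroid n r} (h : P.IsFace Q) (t : Fin s → ℂˣ)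
    (f : P.RRing) : Q.torusAct t (faceHomR h f) = faceHomR h (P.torusAct t f) := by
  rw [← AlgHom.comp_apply, ← AlgHom.comp_apply]
  congr 1
  apply P.algHom_ext
  intro b
  simp only [AlgHom.comp_apply, torusAct_X, map_smul, faceHomR, liftR_toRRing, inclB,
    MvPolynomial.rename_X]

/-- The homomorphism of coordinate rings of strata induced by the inclusion `B_P ⊆ B_Q`. -/
noncomputable def faceHom {P Q : FlagMatroid n r} (h : P.IsFace Q) :
    P.coordRing →ₐ[ℂ] Q.coordRing :=
  ((faceHomR h).comp P.coordRing.val).codRestrict Q.coordRing fun f t => by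
    rw [AlgHom.comp_apply, faceHomR_torusAct]
    exact congrArg _ (f.2 t)

/-- The face morphism `Fl(Q) ⟶ Fl(P)` for `P ≤ Q`. -/
noncomputable def faceMorphism {P Q : FlagMatroid n r} (h : P.IsFace Q) :
    Q.stratum ⟶ P.stratum :=
  Spec.map (CommRingCat.ofHom (faceHom h).toRingHom)

end FlagMatroid

/-! In suitable coordinates the face morphism is a coordinate projection between open pieces of
affine spaces. If `A` is a finitely presented localization of a polynomial ring `B[y]`, then `B → A`
is smooth and injective, and every prime of `B` contracted from `A` extends to a prime of `A`. That
prime is the generic point of the fiber, so nonempty fibers are irreducible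
(`isSmoothConnected_algebraMap`, `isConnected_fiber_of_isPrime_map`).

To reach this situation, choose a flag of bases of `P` (`FlagMatroid.exists_isChart`); it is a flag
of bases of `Q` too. In the chart of the flag variety around it, all Plücker coordinates are
polynomials in six of them (`ChartCoord.plucker`). On a stratum some of the six vanish, and others
are tied together by the vanishing of further Plücker coordinates. A subset `I` of the six is a
coordinate system (`IsCoordSystem`) if all six are rational in those of `I`, and if generic values
on `I` extend to a complex point of the stratum. The first condition gives generation up to
inverses, the second algebraic independence; only five relations of the flag ideal are needed. If a
system `I` for `P` lies in a system `I'` for `Q`, the face morphism forgets the coordinates in `I' \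
I` (`FlagMatroid.isSmoothConnected_faceHom`).

Internality enters through one consequence: every constituent of `P` has at least two bases
(`FlagMatroid.IsInternal.exists_ne`). A unique basis `S` would place `Δ(P)` in the proper face of
`Δ(r, n)` on which the sum of the coordinates in `S` is maximal. Normalize the weight vector of the
face to `(0, b, c, d)` in the chart. Bases of `Q` have nonnegative excess over the standard flag,
and those of `P` are the ones of excess zero. The second bases force `d = 0`, or `c = 0` and `b = d
≠ 0`. Unless `P = Q`, the signs of `b, c, d` then make enough Plücker coordinates vanish on `Q` for
a compatible pair of coordinate systems to exist (`IsFlagPattern.exists_isCoordSystem`). Generic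
points are constructed from conditions saying that certain relations cannot have exactly one nonzero
term; these follow from basis exchange (`FlagMatroid.IsChart.isFlagPattern`). -/

/-! ### Localizations of polynomial rings and their fibers -/

section RingTheory

theorem MvPolynomial.map_C_isPrime {σ R : Type*} [CommRing R] (I : Ideal R) [I.IsPrime] :
    (I.map (MvPolynomial.C : R →+* MvPolynomial σ R)).IsPrime := by
  rw [← Ideal.Quotient.isDomain_iff_prime]
  exact (MvPolynomial.quotientEquivQuotientMvPolynomial (σ := σ) I).symm.toMulEquiv.isDomain _

/-- If, for every prime `q` of `A` over `p`, the extension of `p` to `A` is prime, then the nonempty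
fibers of `Spec A → Spec B` are connected. -/
theorem isConnected_fiber_of_isPrime_map {B A : Type*} [CommRing B] [CommRing A] (φ : B →+* A)
    (h : ∀ q : Ideal A, q.IsPrime → ((q.comap φ).map φ).IsPrime) (q : PrimeSpectrum A) :
    _root_.IsConnected (PrimeSpectrum.comap φ ⁻¹' {PrimeSpectrum.comap φ q}) := by
  -- The extended ideal is the least prime in the fiber, hence its generic point; the fiber lies
  -- between `{η}` and its closure.
  let η : PrimeSpectrum A := ⟨_, h q.asIdeal q.isPrime⟩
  have hη : PrimeSpectrum.comap φ η = PrimeSpectrum.comap φ q := by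
    ext1
    exact le_antisymm (Ideal.comap_mono Ideal.map_comap_le) Ideal.le_comap_map
  refine ⟨⟨q, rfl⟩, (isPreconnected_singleton (x := η)).subset_closure ?_ ?_⟩
  · simpa using hη
  · intro q' hq'
    rw [← specializes_iff_mem_closure, ← PrimeSpectrum.le_iff_specializes]
    show Ideal.map φ (Ideal.comap φ q.asIdeal) ≤ q'.asIdeal
    rw [Ideal.map_le_iff_le_comap]
    exact (congrArg PrimeSpectrum.asIdeal hq').ge

/-- A ring homomorphism that is smooth, injective, and such that extensions of contracted primes
are prime. -/
structure RingHom.IsSmoothConnected {B A : Type*} [CommRing B] [CommRing A] (φ : B →+* A) :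
    Prop where
  smooth : φ.Smooth
  injective : Function.Injective φ
  isPrime_map : ∀ q : Ideal A, q.IsPrime → ((q.comap φ).map φ).IsPrime

theorem RingHom.IsSmoothConnected.of_bijective {B A : Type*} [CommRing B] [CommRing A]
    {φ : B →+* A} (hφ : Function.Bijective φ) : φ.IsSmoothConnected where
  smooth := .of_bijective hφ
  injective := hφ.1
  isPrime_map q hq := by rwa [Ideal.map_comap_of_surjective φ hφ.2]

theorem RingHom.IsSmoothConnected.spec {B A : Type} [CommRing B] [CommRing A] {φ : B →+* A}
    (hφ : φ.IsSmoothConnected) :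
    AlgebraicGeometry.Smooth (Spec.map (CommRingCat.ofHom φ)) ∧ IsDominant (Spec.map (CommRingCat.ofHom φ)) ∧
      ∀ y ∈ Set.range (Spec.map (CommRingCat.ofHom φ)),
        ConnectedSpace ((Spec.map (CommRingCat.ofHom φ)).fiber y) := by
  refine ⟨?_, ⟨?_⟩, ?_⟩
  · rw [HasRingHomProperty.Spec_iff (P := @AlgebraicGeometry.Smooth)]
    exact hφ.smooth
  · have := (PrimeSpectrum.denseRange_comap_iff_ker_le_nilRadical φ).mpr
      (by rw [(RingHom.injective_iff_ker_eq_bot φ).mp hφ.injective]; exact bot_le)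
    exact this
  · rintro _ ⟨q, rfl⟩
    have h1 : _root_.IsConnected ((Spec.map (CommRingCat.ofHom φ)) ⁻¹'
        {(Spec.map (CommRingCat.ofHom φ)) q}) :=
      isConnected_fiber_of_isPrime_map φ hφ.isPrime_map q
    have := isConnected_iff_connectedSpace.mp h1
    exact (Scheme.Hom.fiberHomeo (Spec.map (CommRingCat.ofHom φ)) _).symm.surjective.connectedSpace
      (Homeomorph.continuous _)

/-- A subalgebra that contains the inverses of its elements, as far as they exist. -/
def Subalgebra.InvClosed {R A : Type*} [CommRing R] [CommRing A] [Algebra R A]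
    (L : Subalgebra R A) : Prop :=
  ∀ x y, x ∈ L → x * y = 1 → y ∈ L

/-- The set `S` generates the `R`-algebra `A` up to inverses. -/
def RatGenerates (R : Type*) {A : Type*} [CommRing R] [CommRing A] [Algebra R A] (S : Set A) :
    Prop :=
  ∀ L : Subalgebra R A, L.InvClosed → S ⊆ L → L = ⊤

/-- The fractions of polynomials in the `y j`. -/
noncomputable def fractionSubalgebra (R : Type*) {A J : Type*} [CommRing R] [CommRing A] [Algebra R A]
    (y : J → A) : Subalgebra R A where
  carrier := {a | ∃ f m : MvPolynomial J R, IsUnit (MvPolynomial.aeval y m) ∧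
    a * MvPolynomial.aeval y m = MvPolynomial.aeval y f}
  mul_mem' := by
    rintro a b ⟨f, m, hm, e⟩ ⟨g, k, hk, e'⟩
    refine ⟨f * g, m * k, ?_, ?_⟩
    · rw [map_mul]; exact hm.mul hk
    · rw [map_mul, map_mul, ← e, ← e']; ring
  add_mem' := by
    rintro a b ⟨f, m, hm, e⟩ ⟨g, k, hk, e'⟩
    refine ⟨f * k + g * m, m * k, ?_, ?_⟩
    · rw [map_mul]; exact hm.mul hk
    · rw [map_add, map_mul, map_mul, map_mul, ← e, ← e']; ring
  algebraMap_mem' r := ⟨MvPolynomial.C r, 1, by simp, by simp⟩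

theorem fractionSubalgebra_invClosed (R : Type*) {A J : Type*} [CommRing R] [CommRing A]
    [Algebra R A] (y : J → A) : (fractionSubalgebra R y).InvClosed := by
  rintro a b ⟨f, m, hm, e⟩ hab
  refine ⟨m, f, ?_, ?_⟩
  · rw [← e]; exact (IsUnit.of_mul_eq_one _ hab).mul hm
  · rw [← e, ← mul_assoc, mul_comm b, hab, one_mul]

theorem mem_fractionSubalgebra_self (R : Type*) {A J : Type*} [CommRing R] [CommRing A]
    [Algebra R A] (y : J → A) (j : J) : y j ∈ fractionSubalgebra R y :=
  ⟨MvPolynomial.X j, 1, by simp, by simp⟩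

theorem RatGenerates.exists_fraction {R A J : Type*} [CommRing R] [CommRing A]
    [Algebra R A] {y : J → A} (h : RatGenerates R (Set.range y)) (a : A) :
    ∃ f m : MvPolynomial J R, IsUnit (MvPolynomial.aeval y m) ∧
    a * MvPolynomial.aeval y m = MvPolynomial.aeval y f := by
  have := h _ (fractionSubalgebra_invClosed R y)
    (by rintro _ ⟨j, rfl⟩; exact mem_fractionSubalgebra_self R y j)
  show a ∈ fractionSubalgebra R y
  rw [this]; trivial

/-- The monoid of polynomials whose value at `y` is a unit. -/
noncomputable def unitValues (R : Type*) {A J : Type*} [CommRing R] [CommRing A] [Algebra R A] (y : J → A) :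
    Submonoid (MvPolynomial J R) :=
  (IsUnit.submonoid A).comap (MvPolynomial.aeval y : MvPolynomial J R →ₐ[R] A)

/-- Evaluation at `y` exhibits `A` as the localization of `B[y]` at all polynomials with unit value.
Polynomial extensions and localizations are formally smooth. The extension of a prime of `B` to
`B[y]` is prime, and stays prime in `A` if it contains no polynomial with unit value. -/
theorem isSmoothConnected_algebraMap {B A J : Type} [CommRing B] [CommRing A] [Algebra B A]
    [Algebra.FinitePresentation B A] {y : J → A} (hy : AlgebraicIndependent B y)
    (hgen : RatGenerates B (Set.range y)) : (algebraMap B A).IsSmoothConnected := by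
  algebraize [(MvPolynomial.aeval y : MvPolynomial J B →ₐ[B] A).toRingHom]
  have hmap : ∀ f, algebraMap (MvPolynomial J B) A f = MvPolynomial.aeval y f := fun _ => rfl
  have : IsScalarTower B (MvPolynomial J B) A := IsScalarTower.of_algebraMap_eq fun b => by
    rw [hmap, MvPolynomial.algebraMap_eq, MvPolynomial.aeval_C]
  have hloc : IsLocalization (unitValues B y) A := by
    -- Algebraic independence makes the evaluation injective, so equality in `A` needs no
    -- multiplier: the witness is `1`.
    refine ⟨fun m => m.2, fun a => ?_, fun {f g} e => ⟨1, ?_⟩⟩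
    · obtain ⟨f, m, hm, e⟩ := hgen.exists_fraction a
      exact ⟨(f, ⟨m, hm⟩), e⟩
    · rw [hy e]
  have hsm : Algebra.FormallySmooth (MvPolynomial J B) A :=
    Algebra.FormallySmooth.of_isLocalization (unitValues B y)
  have hsm' : Algebra.FormallySmooth B A := Algebra.FormallySmooth.comp B (MvPolynomial J B) A
  refine ⟨RingHom.smooth_algebraMap.mpr ⟨hsm', inferInstance⟩, hy.algebraMap_injective,
    fun q hq => ?_⟩
  have hp : (q.comap (algebraMap B A)).IsPrime := Ideal.comap_isPrime _ _
  have h1 := MvPolynomial.map_C_isPrime (σ := J) (q.comap (algebraMap B A))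
  have h2 : (q.comap (algebraMap B A)).map (algebraMap B A) =
      ((q.comap (algebraMap B A)).map MvPolynomial.C).map (algebraMap (MvPolynomial J B) A) := by
    rw [Ideal.map_map, IsScalarTower.algebraMap_eq B (MvPolynomial J B) A]
    rfl
  rw [h2]
  refine IsLocalization.isPrime_of_isPrime_disjoint (unitValues B y) A _ h1 ?_
  -- Polynomials with coefficients in the contracted prime take values in `q`, so none of these
  -- values is a unit.
  have h3 : (q.comap (algebraMap B A)).map MvPolynomial.C ≤
      q.comap (algebraMap (MvPolynomial J B) A) := by
    rw [Ideal.map_le_iff_le_comap]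
    intro b hb
    show algebraMap (MvPolynomial J B) A (algebraMap B (MvPolynomial J B) b) ∈ q
    rw [← IsScalarTower.algebraMap_apply]
    exact hb
  rw [Set.disjoint_left]
  intro m hm hm'
  exact hq.ne_top (Ideal.eq_top_of_isUnit_mem _ (h3 hm') hm)

theorem aeval_sumAlgEquiv_symm {k B A K J : Type*} [CommRing k] [CommRing B]
    [CommRing A] [Algebra k B] [Algebra B A] [Algebra k A] [IsScalarTower k B A] (z : K → B)
    (y : J → A) (g : MvPolynomial J (MvPolynomial K k)) :
    MvPolynomial.aeval (Sum.elim y fun i => algebraMap B A (z i))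
      ((MvPolynomial.sumAlgEquiv k J K).symm g) =
    MvPolynomial.aeval y
      (MvPolynomial.map (MvPolynomial.aeval z : MvPolynomial K k →ₐ[k] B).toRingHom g) := by
  obtain ⟨p, rfl⟩ := (MvPolynomial.sumAlgEquiv k J K).surjective g
  rw [AlgEquiv.symm_apply_apply]
  induction p using MvPolynomial.induction_on with
  | C r => simp [← IsScalarTower.algebraMap_apply]
  | add p q hp hq => simp only [map_add, hp, hq]
  | mul_X p i h =>
    rw [map_mul, map_mul, map_mul, map_mul, h]
    congr 1
    cases i <;> simp

/-- Elements of `B` are fractions of polynomials in `z` with unit denominators. One unit clears the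
denominators of all coefficients of a relation over `B`, which turns it into a relation over `k`
among `y` and `z` together. -/
theorem AlgebraicIndependent.of_ratGenerates {k B A K J : Type*} [CommRing k] [CommRing B]
    [CommRing A] [Algebra k B] [Algebra B A] [Algebra k A] [IsScalarTower k B A] {z : K → B}
    {y : J → A} (hz : RatGenerates k (Set.range z))
    (h : AlgebraicIndependent k (Sum.elim y fun i => algebraMap B A (z i))) :
    AlgebraicIndependent B y := by
  have hclear : ∀ f : MvPolynomial J B, ∃ m : MvPolynomial K k,
      ∃ g : MvPolynomial J (MvPolynomial K k), IsUnit (MvPolynomial.aeval z m) ∧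
      MvPolynomial.C (MvPolynomial.aeval z m) * f =
        MvPolynomial.map (MvPolynomial.aeval z : MvPolynomial K k →ₐ[k] B).toRingHom g := by
    intro f
    induction f using MvPolynomial.induction_on with
    | C b =>
      obtain ⟨f, m, hm, e⟩ := hz.exists_fraction b
      refine ⟨m, MvPolynomial.C f, hm, ?_⟩
      rw [MvPolynomial.map_C, ← map_mul, mul_comm, e]; rfl
    | add p q hp hq =>
      obtain ⟨m, g, hm, e⟩ := hp
      obtain ⟨m', g', hm', e'⟩ := hq
      refine ⟨m * m', MvPolynomial.C m' * g + MvPolynomial.C m * g', ?_, ?_⟩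
      · rw [map_mul]; exact hm.mul hm'
      · rw [map_add, map_mul, map_mul, map_mul, map_mul, ← e, ← e', MvPolynomial.map_C,
          MvPolynomial.map_C]
        simp only [AlgHom.toRingHom_eq_coe, RingHom.coe_coe]
        ring
    | mul_X p j hp =>
      obtain ⟨m, g, hm, e⟩ := hp
      exact ⟨m, g * MvPolynomial.X j, hm, by rw [map_mul, ← e, MvPolynomial.map_X, mul_assoc]⟩
  rw [AlgebraicIndependent, injective_iff_map_eq_zero]
  intro f hf
  obtain ⟨m, g, hm, e⟩ := hclear f
  have h1 : MvPolynomial.aeval (Sum.elim y fun i => algebraMap B A (z i))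
      ((MvPolynomial.sumAlgEquiv k J K).symm g) = 0 := by
    rw [aeval_sumAlgEquiv_symm, ← e, map_mul, hf, mul_zero]
  have h2 : g = 0 := by
    rw [← (MvPolynomial.sumAlgEquiv k J K).symm.map_eq_zero_iff]
    exact h (h1.trans (map_zero _).symm)
  rw [h2, map_zero] at e
  exact (IsUnit.mul_right_eq_zero (hm.map MvPolynomial.C)).mp e

/-- A homomorphism of finitely generated algebras that are both rationally generated by some of
given elements `yB i` and `yA i`, independent for `A`, where those of `B` are mapped to those of
`A`. -/
theorem isSmoothConnected_of_coords {k B A ι : Type} [Field k] [CommRing B] [CommRing A]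
    [Algebra k B] [Algebra k A] [Algebra.FiniteType k B] [Algebra.FiniteType k A]
    (φ : B →ₐ[k] A) {yB : ι → B} {yA : ι → A} {I I' : Set ι} (hI : I ⊆ I')
    (hφ : ∀ i ∈ I, φ (yB i) = yA i) (hB : RatGenerates k (yB '' I))
    (hA : RatGenerates k (yA '' I')) (h : AlgebraicIndependent k fun i : I' => yA i) :
    φ.toRingHom.IsSmoothConnected := by
  classical
  algebraize [φ.toRingHom]
  have : IsScalarTower k B A := IsScalarTower.of_algebraMap_eq fun r => (φ.commutes r).symm
  have : Algebra.FiniteType B A := Algebra.FiniteType.of_restrictScalars_finiteType k B A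
  have : IsNoetherianRing B := Algebra.FiniteType.isNoetherianRing k B
  have : Algebra.FinitePresentation B A := Algebra.FinitePresentation.of_finiteType.mp ‹_›
  have hz : RatGenerates k (Set.range fun i : I => yB i) := by
    rwa [Set.image_eq_range] at hB
  have hind : AlgebraicIndependent k
      -- The elements indexed by `I' \ I` serve as polynomial variables over `B`, and those indexed
      -- by `I` come from `B`.
      (Sum.elim (fun j : {j : I' // (j : ι) ∉ I} => yA j) fun i : I => algebraMap B A (yB i)) := by
    have e : (Sum.elim (fun j : {j : I' // (j : ι) ∉ I} => yA j)
        fun i : I => algebraMap B A (yB i)) = (fun i : I' => yA i) ∘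
        (Sum.elim (fun j : {j : I' // (j : ι) ∉ I} => j.1) fun i : I => ⟨i.1, hI i.2⟩) := by
      ext (j | i)
      · rfl
      · exact hφ i i.2
    rw [e]
    refine h.comp _ ?_
    rintro (j | i) (j' | i') e
    · exact congrArg _ (Subtype.ext e)
    · exact absurd (show (j.1 : ι) ∈ I by rw [show j.1 = _ from e]; exact i'.2) j.2
    · exact absurd (show (j'.1 : ι) ∈ I by rw [show j'.1 = _ from e.symm]; exact i.2) j'.2
    · have e' : (i : ι) = i' := by simpa using e
      exact congrArg _ (Subtype.ext e')
  refine isSmoothConnected_algebraMap (AlgebraicIndependent.of_ratGenerates hz hind) ?_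
  intro L hL hS
  have := hA (L.restrictScalars k) hL ?_
  · rw [eq_top_iff]
    intro a _
    have : a ∈ L.restrictScalars k := by rw [this]; trivial
    exact this
  · rintro _ ⟨i, hi, rfl⟩
    by_cases hi' : i ∈ I
    · show yA i ∈ L
      rw [← hφ i hi']
      exact L.algebraMap_mem (yB i)
    · exact hS ⟨⟨⟨i, hi⟩, hi'⟩, rfl⟩

end RingTheory

/-! ### Torus invariants and generators of the coordinate ring -/

namespace FlagMatroid

variable {n s : ℕ} {r : Fin s → ℕ}

theorem torusAct_toRRing (Q : FlagMatroid n r) (t : Fin s → ℂˣ) (f : Q.BRing) :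
    Q.torusAct t (Q.toRRing f) = Q.toRRing (rescale (fun b => (t b.1.1 : ℂ)) f) :=
  Q.liftR_toRRing _ _ _ _

/-- The degree of a monomial in the coordinates of the `i`-th factor. -/
noncomputable def monomialDegree (Q : FlagMatroid n r) (m : Q.BasisIndex →₀ ℕ) (i : Fin s) : ℕ :=
  ∑ b ∈ m.support with b.1.1 = i, m b

theorem prod_pow_eq_prod_monomialDegree (Q : FlagMatroid n r) {M : Type*} [CommMonoid M]
    (t : Fin s → M) (m : Q.BasisIndex →₀ ℕ) :
    (m.prod fun b e => t b.1.1 ^ e) = ∏ i, t i ^ Q.monomialDegree m i := by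
  rw [Finsupp.prod, ← Finset.prod_fiberwise m.support (fun b => b.1.1)]
  refine Finset.prod_congr rfl fun i _ => ?_
  rw [monomialDegree, ← Finset.prod_pow_eq_pow_sum]
  refine Finset.prod_congr rfl fun b hb => ?_
  rw [(Finset.mem_filter.mp hb).2]

/-- A point of the torus on which distinct characters take distinct values. -/
theorem exists_units_prod_pow_injective (s : ℕ) :
    ∃ t : Fin s → ℂˣ, ∀ a b : Fin s → ℕ,
      ∏ i, (t i : ℂ) ^ a i = ∏ i, (t i : ℂ) ^ b i → a = b := by
  -- Distinct primes as entries: unique factorization recovers the exponents.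
  let p : Fin s → ℕ := fun i => Nat.nth Nat.Prime i
  have hp : ∀ i, (p i).Prime := fun i => Nat.prime_nth_prime i
  have hinj : Function.Injective p := fun i j h =>
    Fin.ext (Nat.nth_injective Nat.infinite_setOfPred_prime h)
  refine ⟨fun i => Units.mk0 (p i : ℂ) (Nat.cast_ne_zero.mpr (hp i).ne_zero), fun a b h => ?_⟩
  have h' : ∏ i, p i ^ a i = ∏ i, p i ^ b i := by
    simp only [Units.val_mk0] at h
    exact_mod_cast h
  have key : ∀ (a : Fin s → ℕ) (j : Fin s), (∏ i, p i ^ a i).factorization (p j) = a j := by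
    intro a j
    rw [Nat.factorization_prod fun i _ => pow_ne_zero _ (hp i).ne_zero, Finsupp.finsetSum_apply,
      Finset.sum_eq_single j]
    · simp [(hp j).factorization_pow]
    · intro i _ hij
      rw [(hp i).factorization_pow, Finsupp.single_eq_of_ne (fun e => hij (hinj e).symm)]
    · simp
  ext j
  rw [← key a j, h', key b j]

/-- The quotient of the coordinates of two bases of the same constituent. -/
noncomputable def ratio (Q : FlagMatroid n r) (b c : Q.BasisIndex) (h : b.1.1 = c.1.1) :
    Q.coordRing :=
  ⟨Q.toRRing (MvPolynomial.X b) * Ring.inverse (Q.toRRing (MvPolynomial.X c)), fun t => by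
    have h1 : Q.torusAct t (Ring.inverse (Q.toRRing (MvPolynomial.X c))) *
        ((t c.1.1 : ℂ) • Q.toRRing (MvPolynomial.X c)) = 1 := by
      rw [← torusAct_X, ← map_mul, Ring.inverse_mul_cancel _ (Q.isUnit_toRRing_X c), map_one]
    refine (Q.isUnit_toRRing_X c).mul_left_injective ?_
    beta_reduce
    rw [map_mul, torusAct_X, h, mul_assoc (Q.toRRing _), Ring.inverse_mul_cancel _
      (Q.isUnit_toRRing_X c), mul_one]
    calc _ = Q.toRRing (MvPolynomial.X b) *
          (Q.torusAct t (Ring.inverse (Q.toRRing (MvPolynomial.X c))) *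
        ((t c.1.1 : ℂ) • Q.toRRing (MvPolynomial.X c))) := by
          simp only [Algebra.smul_def]; ring
      _ = _ := by rw [h1, mul_one]⟩

theorem ratio_mul (Q : FlagMatroid n r) (b c : Q.BasisIndex) (h : b.1.1 = c.1.1) :
    (Q.ratio b c h : Q.RRing) * Q.toRRing (MvPolynomial.X c) = Q.toRRing (MvPolynomial.X b) := by
  rw [ratio, mul_assoc, Ring.inverse_mul_cancel _ (Q.isUnit_toRRing_X c), mul_one]

theorem ratio_mul_ratio (Q : FlagMatroid n r) (b c : Q.BasisIndex) (h : b.1.1 = c.1.1) :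
    Q.ratio b c h * Q.ratio c b h.symm = 1 := by
  apply Subtype.ext
  refine (Q.isUnit_toRRing_X b).mul_left_injective ?_
  beta_reduce
  rw [Subalgebra.coe_mul, mul_assoc, ratio_mul, ratio_mul, Subalgebra.coe_one, one_mul]

theorem exists_monomial_of_mem_SMonoid (Q : FlagMatroid n r) {x : Q.BRing ⧸ Q.ideal}
    (hx : x ∈ Q.SMonoid) :
    ∃ m : Q.BasisIndex →₀ ℕ, x = Ideal.Quotient.mk Q.ideal (MvPolynomial.monomial m 1) := by
  induction hx using Submonoid.closure_induction with
  | mem x hx => obtain ⟨b, rfl⟩ := hx; exact ⟨_, rfl⟩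
  | one => exact ⟨0, by simp⟩
  | mul x y _ _ hx hy =>
    obtain ⟨m, rfl⟩ := hx
    obtain ⟨m', rfl⟩ := hy
    exact ⟨m + m', by rw [← map_mul, MvPolynomial.monomial_mul, mul_one]⟩

theorem exists_mul_monomial_eq (Q : FlagMatroid n r) (f : Q.RRing) :
    ∃ (m : Q.BasisIndex →₀ ℕ) (g : Q.BRing),
      f * Q.toRRing (MvPolynomial.monomial m 1) = Q.toRRing g := by
  obtain ⟨⟨x, y⟩, e⟩ := IsLocalization.surj Q.SMonoid f
  obtain ⟨m, hm⟩ := Q.exists_monomial_of_mem_SMonoid y.2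
  obtain ⟨g, rfl⟩ := Ideal.Quotient.mk_surjective x
  refine ⟨m, g, ?_⟩
  simp only [hm] at e
  exact e

theorem isUnit_toRRing_monomial (Q : FlagMatroid n r) (m : Q.BasisIndex →₀ ℕ) :
    IsUnit (Q.toRRing (MvPolynomial.monomial m 1)) := by
  rw [MvPolynomial.monomial_eq, map_one, one_mul, Finsupp.prod, map_prod]
  exact Finset.prod_induction _ IsUnit (fun _ _ => IsUnit.mul) isUnit_one fun b _ => by
    rw [map_pow]; exact (Q.isUnit_toRRing_X b).pow _

/-- An invariant is a polynomial over a monomial. The terms whose multidegree is that of the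
denominator are combinations of products of ratios. The others are eigenvectors of a generic torus
element with eigenvalue different from `1`, so their sum, being invariant, vanishes. -/
theorem eq_top_of_ratio_mem (Q : FlagMatroid n r) (b₀ : Fin s → Q.BasisIndex)
    (hb₀ : ∀ i, (b₀ i).1.1 = i) (L : Subalgebra ℂ Q.coordRing)
    (h1 : ∀ b, Q.ratio b (b₀ b.1.1) (hb₀ _).symm ∈ L)
    (h2 : ∀ b, Q.ratio (b₀ b.1.1) b (hb₀ _) ∈ L) : L = ⊤ := by
  classical
  obtain ⟨t, ht⟩ := exists_units_prod_pow_injective s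
  -- the two products of ratios of exponent vector `m`
  let ρ : (Q.BasisIndex →₀ ℕ) → Q.coordRing := fun m =>
    m.prod fun b e => Q.ratio b (b₀ b.1.1) (hb₀ _).symm ^ e
  let ρ' : (Q.BasisIndex →₀ ℕ) → Q.coordRing := fun m =>
    m.prod fun b e => Q.ratio (b₀ b.1.1) b (hb₀ _) ^ e
  have hρ : ∀ m, ρ m ∈ L := fun m => L.prod_mem fun b _ => L.pow_mem (h1 b) _
  have hρ' : ∀ m, ρ' m ∈ L := fun m => L.prod_mem fun b _ => L.pow_mem (h2 b) _
  have hρρ' : ∀ m, ρ m * ρ' m = 1 := fun m => by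
    simp only [ρ, ρ', ← Finsupp.prod_mul, ← mul_pow, ratio_mul_ratio, one_pow]
    exact Finset.prod_const_one
  let W : (Q.BasisIndex →₀ ℕ) → Q.RRing := fun m =>
    ∏ i, Q.toRRing (MvPolynomial.X (b₀ i)) ^ Q.monomialDegree m i
  have hmon : ∀ m, Q.toRRing (MvPolynomial.monomial m 1) = (ρ m : Q.RRing) * W m := by
    intro m
    have : (ρ m : Q.RRing) =
        m.prod fun b e => (Q.ratio b (b₀ b.1.1) (hb₀ _).symm : Q.RRing) ^ e := by
      simp only [ρ, Finsupp.prod]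
      rw [← Subalgebra.coe_val, map_prod]
      simp
    simp only [W]
    rw [this, ← Q.prod_pow_eq_prod_monomialDegree (fun i => Q.toRRing (MvPolynomial.X (b₀ i))),
      ← Finsupp.prod_mul]
    simp only [← mul_pow, ratio_mul]
    rw [MvPolynomial.monomial_eq, map_one, one_mul, Finsupp.prod, map_prod]
    simp only [map_pow]
    rfl
  rw [eq_top_iff]
  rintro f -
  obtain ⟨m, g, hg⟩ := Q.exists_mul_monomial_eq f
  obtain ⟨u, hu⟩ := (Q.isUnit_toRRing_monomial m).exists_right_inv
  let T := Q.torusAct t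
  have hT : ∀ k, T (Q.toRRing (MvPolynomial.monomial k 1)) =
      (∏ i, (t i : ℂ) ^ Q.monomialDegree k i) • Q.toRRing (MvPolynomial.monomial k 1) := fun k => by
    simp only [T]
    rw [torusAct_toRRing, rescale_monomial, Q.prod_pow_eq_prod_monomialDegree (fun i => (t i : ℂ)),
      ← MvPolynomial.smul_eq_C_mul, map_smul]
  have htne : ∏ i, (t i : ℂ) ^ Q.monomialDegree m i ≠ 0 :=
    Finset.prod_ne_zero_iff.mpr fun i _ => pow_ne_zero _ (t i).ne_zero
  have hTu : T u = (∏ i, (t i : ℂ) ^ Q.monomialDegree m i)⁻¹ • u := by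
    have e1 : T (Q.toRRing (MvPolynomial.monomial m 1)) * T u = 1 := by
      rw [← map_mul, hu, map_one]
    calc T u = (∏ i, (t i : ℂ) ^ Q.monomialDegree m i)⁻¹ •
          (T (Q.toRRing (MvPolynomial.monomial m 1)) * T u * u) := by
          rw [hT, smul_mul_assoc, smul_mul_assoc, smul_smul, inv_mul_cancel₀ htne, one_smul,
            mul_right_comm, hu, one_mul]
      _ = _ := by rw [e1, one_mul]
  let S₀ := g.support.filter fun k => Q.monomialDegree k = Q.monomialDegree m
  let S₁ := g.support.filter fun k => ¬ Q.monomialDegree k = Q.monomialDegree m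
  let f₀ : Q.coordRing := ∑ k ∈ S₀, g.coeff k • (ρ k * ρ' m)
  have hf₀ : f₀ ∈ L := L.sum_mem fun k _ => L.smul_mem (L.mul_mem (hρ k) (hρ' m)) _
  have hterm : ∀ k ∈ S₀, ((g.coeff k • (ρ k * ρ' m) : Q.coordRing) : Q.RRing) =
      Q.toRRing (MvPolynomial.monomial k (g.coeff k)) * u := by
    intro k hk
    have hd := (Finset.mem_filter.mp hk).2
    have hW : W k = W m := by simp only [W, hd]
    have e1 : ((ρ m : Q.RRing)) * ρ' m = 1 := by rw [← Subalgebra.coe_mul, hρρ']; rfl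
    have e2 : (ρ' m : Q.RRing) = W m * u := by
      calc (ρ' m : Q.RRing) = ρ' m * (Q.toRRing (MvPolynomial.monomial m 1) * u) := by
            rw [hu, mul_one]
        _ = (ρ m * ρ' m) * (W m * u) := by rw [hmon]; ring
        _ = _ := by rw [e1, one_mul]
    rw [show MvPolynomial.monomial k (g.coeff k) = g.coeff k • MvPolynomial.monomial k (1 : ℂ) by
      rw [MvPolynomial.smul_monomial, smul_eq_mul, mul_one], map_smul, hmon k, hW,
      Subalgebra.coe_smul, Subalgebra.coe_mul, e2, smul_mul_assoc, mul_assoc]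
  have hf : (f : Q.RRing) = ∑ k ∈ g.support, Q.toRRing (MvPolynomial.monomial k (g.coeff k)) * u := by
    rw [← Finset.sum_mul, ← map_sum, ← g.as_sum, ← hg, mul_assoc, hu, mul_one]
  -- The difference is invariant and equals a sum of eigenvectors of nontrivial eigenvalues;
  -- `mem_of_sub_sum_mem` for the zero subspace shows that it is zero.
  have key : ((f - f₀ : Q.coordRing) : Q.RRing) ∈ (⊥ : Submodule ℂ Q.RRing) := by
    refine mem_of_sub_sum_mem ⊥ T.toLinearMap (fun v hv => ?_) _ ((f - f₀ : Q.coordRing).2 t)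
      (fun k => (∏ i, (t i : ℂ) ^ Q.monomialDegree k i) *
        (∏ i, (t i : ℂ) ^ Q.monomialDegree m i)⁻¹) S₁ (fun k hk => ?_)
      (fun k => Q.toRRing (MvPolynomial.monomial k (g.coeff k)) * u) (fun k hk => ?_) ?_
    · rw [(Submodule.mem_bot ℂ).mp hv, map_zero]; exact Submodule.zero_mem _
    · intro e
      refine (Finset.mem_filter.mp hk).2 (ht _ _ ?_)
      exact (mul_inv_eq_one₀ htne).mp e
    · rw [show MvPolynomial.monomial k (g.coeff k) = g.coeff k • MvPolynomial.monomial k (1 : ℂ) by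
        rw [MvPolynomial.smul_monomial, smul_eq_mul, mul_one], map_smul, AlgHom.toLinearMap_apply,
        map_mul, map_smul, hT, hTu]
      simp only [Algebra.smul_def, map_mul]
      ring
    · rw [Submodule.mem_bot, Subalgebra.coe_sub, hf]
      have : (f₀ : Q.RRing) = ∑ k ∈ S₀, Q.toRRing (MvPolynomial.monomial k (g.coeff k)) * u := by
        rw [← Finset.sum_congr rfl hterm, ← Subalgebra.coe_val, map_sum]
      rw [this, ← Finset.sum_filter_add_sum_filter_not g.support
        (fun k => Q.monomialDegree k = Q.monomialDegree m)]
      ring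
  have : f - f₀ = 0 := Subtype.ext ((Submodule.mem_bot ℂ).mp key)
  rw [sub_eq_zero.mp this]
  exact hf₀

theorem exists_basisIndex (Q : FlagMatroid n r) :
    ∃ b₀ : Fin s → Q.BasisIndex, ∀ i, (b₀ i).1.1 = i := by
  choose b hb using Q.bases_nonempty
  exact ⟨fun i => ⟨(i, b i), hb i⟩, fun i => rfl⟩

instance (Q : FlagMatroid n r) : Algebra.FiniteType ℂ Q.coordRing := by
  classical
  obtain ⟨b₀, hb₀⟩ := Q.exists_basisIndex
  let S : Set Q.coordRing := (Set.range fun b => Q.ratio b (b₀ b.1.1) (hb₀ _).symm) ∪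
      Set.range fun b => Q.ratio (b₀ b.1.1) b (hb₀ _)
  have h1 : ∀ b, Q.ratio b (b₀ b.1.1) (hb₀ _).symm ∈ S := fun b => Or.inl (Set.mem_range_self b)
  have h2 : ∀ b, Q.ratio (b₀ b.1.1) b (hb₀ _) ∈ S := fun b => Or.inr (Set.mem_range_self b)
  have h : Algebra.adjoin ℂ S = ⊤ := Q.eq_top_of_ratio_mem b₀ hb₀ (Algebra.adjoin ℂ S)
    (fun b => Algebra.subset_adjoin (h1 b)) (fun b => Algebra.subset_adjoin (h2 b))
  refine ⟨?_⟩
  rw [← h]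
  exact Subalgebra.fg_def.mpr ⟨S, (Set.finite_range _).union (Set.finite_range _), rfl⟩

theorem ratGenerates_ratio (Q : FlagMatroid n r) (b₀ : Fin s → Q.BasisIndex)
    (hb₀ : ∀ i, (b₀ i).1.1 = i) :
    RatGenerates ℂ (Set.range fun b => Q.ratio b (b₀ b.1.1) (hb₀ _).symm) := fun L hL hS =>
  Q.eq_top_of_ratio_mem b₀ hb₀ L (fun b => hS ⟨b, rfl⟩)
    fun b => hL _ _ (hS ⟨b, rfl⟩) (Q.ratio_mul_ratio _ _ _)

end FlagMatroid

/-! ### Alternating Plücker coordinates of tuples of columns -/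

/-- A minor with columns listed by an injective tuple is, up to a sign that depends on the tuple
only, an initial minor. -/
theorem exists_sign_initialMinor {n k : ℕ} (hk : k ≤ n) (f : Fin k → Fin n)
    (hf : Function.Injective f) : ∃ ε : ℂ, ε * ε = 1 ∧ ∀ A : Matrix (Fin n) (Fin n) ℂ,
      (A.submatrix (Fin.castLE hk) f).det = ε * initialMinor A (Finset.univ.image f) := by
  obtain ⟨l, hl⟩ : ∃ l, l = Finset.univ.image f := ⟨_, rfl⟩
  have hcard : k = l.card := by rw [hl, Finset.card_image_of_injective _ hf, Finset.card_fin]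
  rw [← hl]
  have hmem : ∀ i, f i ∈ l := fun i => by rw [hl]; exact Finset.mem_image_of_mem _ (Finset.mem_univ i)
  clear hl
  subst hcard
  -- The permutation that sorts the tuple; its sign is the required factor.
  let π : Fin l.card → Fin l.card := fun i => (l.orderIsoOfFin rfl).symm ⟨f i, hmem i⟩
  have hπ : Function.Injective π := fun i j h => hf (by simpa [π] using h)
  let τ : Equiv.Perm (Fin l.card) := Equiv.ofBijective π (Finite.injective_iff_bijective.mp hπ)
  refine ⟨((Equiv.Perm.sign τ : ℤ) : ℂ), ?_, fun A => ?_⟩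
  · rw [← Int.cast_mul, ← Units.val_mul, Int.units_mul_self]; simp
  · rw [initialMinor, ← Matrix.det_permute']
    congr 1
    ext i j
    have : l.orderEmbOfFin rfl (τ j) = f j := by
      rw [← Finset.coe_orderIsoOfFin_apply]
      simp [τ, π]
    simp [this]

section Signed

variable {n s : ℕ} {r : Fin s → ℕ}

theorem card_image_eq {k : ℕ} {f : Fin k → Fin n} (hf : Function.Injective f) :
    (Finset.univ.image f).card = k := by
  rw [Finset.card_image_of_injective _ hf, Finset.card_fin]

theorem le_of_injective_fin {k : ℕ} {f : Fin k → Fin n} (hf : Function.Injective f) : k ≤ n := by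
  simpa using Fintype.card_le_of_injective f hf

/-- The sign by which the minor with columns `f` differs from the initial minor. -/
noncomputable def columnSign {k : ℕ} (f : Fin k → Fin n) (hf : Function.Injective f) : ℂ :=
  (exists_sign_initialMinor (le_of_injective_fin hf) f hf).choose

theorem columnSign_mul_self {k : ℕ} (f : Fin k → Fin n) (hf : Function.Injective f) :
    columnSign f hf * columnSign f hf = 1 :=
  (exists_sign_initialMinor (le_of_injective_fin hf) f hf).choose_spec.1

theorem columnSign_ne_zero {k : ℕ} (f : Fin k → Fin n) (hf : Function.Injective f) :
    columnSign f hf ≠ 0 := left_ne_zero_of_mul_eq_one (columnSign_mul_self f hf)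

theorem columnSign_mul_initialMinor {k : ℕ} (f : Fin k → Fin n) (hf : Function.Injective f)
    (A : Matrix (Fin n) (Fin n) ℂ) : columnSign f hf * initialMinor A (Finset.univ.image f) =
      (A.submatrix (Fin.castLE (le_of_injective_fin hf)) f).det :=
  ((exists_sign_initialMinor (le_of_injective_fin hf) f hf).choose_spec.2 A).symm

/-- The Plücker index of the set of entries of a tuple. -/
def tupleIndex {i : Fin s} (f : Fin (r i) → Fin n) (hf : Function.Injective f) :
    PluckerIndex n r :=
  ⟨(i, Finset.univ.image f), card_image_eq hf⟩

/-- The alternating Plücker coordinate of a tuple of columns. -/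
noncomputable def tuplePlucker {i : Fin s} (f : Fin (r i) → Fin n) (hf : Function.Injective f) :
    MvPolynomial (PluckerIndex n r) ℂ :=
  MvPolynomial.C (columnSign f hf) * MvPolynomial.X (tupleIndex f hf)

theorem aeval_tuplePlucker {i : Fin s} (f : Fin (r i) → Fin n) (hf : Function.Injective f)
    {p : PluckerIndex n r → ℂ} {A : Matrix (Fin n) (Fin n) ℂ} {c : Fin s → ℂˣ}
    (hp : ∀ x : PluckerIndex n r, p x = c x.1.1 * initialMinor A x.1.2) :
    MvPolynomial.aeval p (tuplePlucker f hf) =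
      c i * (A.submatrix (Fin.castLE (le_of_injective_fin hf)) f).det := by
  rw [tuplePlucker, map_mul, MvPolynomial.aeval_C, MvPolynomial.aeval_X, hp,
    ← columnSign_mul_initialMinor f hf]
  simp only [tupleIndex, Algebra.algebraMap_self, RingHom.id_apply]
  ring

end Signed

/-! ### Relations, complex points and affine coordinates on a stratum -/

namespace FlagMatroid

variable {n s : ℕ} {r : Fin s → ℕ}

open Classical in
/-- The homomorphism from the full polynomial ring to `R_Q` that kills the coordinates of
non-bases. -/
noncomputable def pluckerHom (Q : FlagMatroid n r) :
    MvPolynomial (PluckerIndex n r) ℂ →ₐ[ℂ] Q.RRing :=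
  MvPolynomial.aeval fun x => if h : x.1.2 ∈ Q.bases x.1.1 then
    Q.toRRing (MvPolynomial.X ⟨x.1, h⟩) else 0

theorem pluckerHom_X_of_mem (Q : FlagMatroid n r) (x : PluckerIndex n r)
    (h : x.1.2 ∈ Q.bases x.1.1) :
    Q.pluckerHom (MvPolynomial.X x) = Q.toRRing (MvPolynomial.X ⟨x.1, h⟩) := by
  rw [pluckerHom, MvPolynomial.aeval_X, dif_pos h]

theorem pluckerHom_X_of_notMem (Q : FlagMatroid n r) (x : PluckerIndex n r)
    (h : x.1.2 ∉ Q.bases x.1.1) : Q.pluckerHom (MvPolynomial.X x) = 0 := by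
  rw [pluckerHom, MvPolynomial.aeval_X, dif_neg h]

theorem pluckerHom_eq_zero (Q : FlagMatroid n r) {f : MvPolynomial (PluckerIndex n r) ℂ}
    (hf : f ∈ Q.bigIdeal) : Q.pluckerHom f = 0 := by
  classical
  -- the projection to `B_Q`
  let π : MvPolynomial (PluckerIndex n r) ℂ →ₐ[ℂ] Q.BRing :=
    MvPolynomial.aeval fun x => if h : x.1.2 ∈ Q.bases x.1.1 then MvPolynomial.X ⟨x.1, h⟩ else 0
  have h1 : Q.pluckerHom = Q.toRRing.comp π := by
    apply MvPolynomial.algHom_ext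
    intro x
    by_cases h : x.1.2 ∈ Q.bases x.1.1
    · rw [Q.pluckerHom_X_of_mem x h]; simp [π, h]
    · rw [Q.pluckerHom_X_of_notMem x h]; simp [π, h]
  -- Killing the coordinates of non-bases changes nothing modulo `Q.bigIdeal`, so the projection of
  -- an element of that ideal lies in `Q.ideal`.
  have h2 : ∀ f, MvPolynomial.rename Q.basisIncl (π f) - f ∈ Q.bigIdeal := by
    intro f
    rw [← Ideal.Quotient.eq]
    have : ((Ideal.Quotient.mkₐ ℂ Q.bigIdeal).comp (MvPolynomial.rename Q.basisIncl)).comp π =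
        Ideal.Quotient.mkₐ ℂ Q.bigIdeal := by
      apply MvPolynomial.algHom_ext
      intro x
      by_cases h : x.1.2 ∈ Q.bases x.1.1
      · simp [π, h, basisIncl]
      · simp only [π, AlgHom.comp_apply, MvPolynomial.aeval_X, dif_neg h, map_zero]
        symm
        exact Ideal.Quotient.eq_zero_iff_mem.mpr
          (Ideal.mem_sup_right (Ideal.subset_span ⟨x, h, rfl⟩))
    exact DFunLike.congr_fun this f
  rw [h1]
  apply Q.toRRing_eq_zero
  show MvPolynomial.rename Q.basisIncl (π f) ∈ Q.bigIdeal
  have := Q.bigIdeal.add_mem (h2 f) hf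
  rwa [sub_add_cancel] at this

theorem pluckerHom_eq_zero_of_flagIdeal (Q : FlagMatroid n r)
    {f : MvPolynomial (PluckerIndex n r) ℂ} (hf : f ∈ flagIdeal n r) : Q.pluckerHom f = 0 :=
  Q.pluckerHom_eq_zero (Ideal.mem_sup_left hf)

/-- A flag whose nonzero Plücker coordinates are indexed by the bases of `Q` is a complex point. -/
theorem exists_algHom_of_mem_flagCone (Q : FlagMatroid n r) {p : PluckerIndex n r → ℂ}
    (hp : p ∈ flagCone n r) (hQ : ∀ x, p x ≠ 0 ↔ x.1.2 ∈ Q.bases x.1.1) :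
    ∃ χ : Q.RRing →ₐ[ℂ] ℂ, ∀ f, χ (Q.pluckerHom f) = MvPolynomial.aeval p f := by
  have hbig : Q.bigIdeal ≤ RingHom.ker (MvPolynomial.aeval p :
      MvPolynomial (PluckerIndex n r) ℂ →ₐ[ℂ] ℂ) := by
    refine sup_le (fun f hf => hf p hp) (Ideal.span_le.mpr ?_)
    rintro _ ⟨x, hx, rfl⟩
    rw [SetLike.mem_coe, RingHom.mem_ker, MvPolynomial.aeval_X]
    exact not_not.mp (mt (hQ x).mp hx)
  let ev : Q.BRing →ₐ[ℂ] ℂ := (MvPolynomial.aeval p).comp (MvPolynomial.rename Q.basisIncl)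
  refine ⟨Q.liftR ev (fun f hf => hbig hf) fun b => ?_, fun f => ?_⟩
  · simp only [ev, AlgHom.comp_apply, MvPolynomial.rename_X, MvPolynomial.aeval_X]
    exact ((hQ _).mpr b.2).isUnit
  · rw [← AlgHom.comp_apply]
    congr 1
    apply MvPolynomial.algHom_ext
    intro x
    by_cases h : x.1.2 ∈ Q.bases x.1.1
    · rw [AlgHom.comp_apply, Q.pluckerHom_X_of_mem x h]
      refine (Q.liftR_toRRing _ _ _ _).trans ?_
      simp [ev, basisIncl]
    · rw [AlgHom.comp_apply, Q.pluckerHom_X_of_notMem x h, map_zero, MvPolynomial.aeval_X]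
      exact (not_not.mp (mt (hQ x).mp h)).symm

section Tuples

variable {i : Fin s}

/-- The alternating Plücker coordinates on the stratum, in `R_Q`. -/
noncomputable def tupleCoord (Q : FlagMatroid n r) (f : Fin (r i) → Fin n)
    (hf : Function.Injective f) : Q.RRing :=
  Q.pluckerHom (tuplePlucker f hf)

theorem tupleCoord_of_mem (Q : FlagMatroid n r) (f : Fin (r i) → Fin n)
    (hf : Function.Injective f) (h : Finset.univ.image f ∈ Q.bases i) :
    Q.tupleCoord f hf = columnSign f hf •
      Q.toRRing (MvPolynomial.X ⟨(i, Finset.univ.image f), h⟩) := by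
  rw [tupleCoord, tuplePlucker, ← MvPolynomial.smul_eq_C_mul, map_smul,
    Q.pluckerHom_X_of_mem _ h]
  rfl

theorem tupleCoord_of_notMem (Q : FlagMatroid n r) (f : Fin (r i) → Fin n)
    (hf : Function.Injective f) (h : Finset.univ.image f ∉ Q.bases i) :
    Q.tupleCoord f hf = 0 := by
  rw [tupleCoord, tuplePlucker, map_mul, Q.pluckerHom_X_of_notMem _ h, mul_zero]

theorem isUnit_tupleCoord (Q : FlagMatroid n r) (f : Fin (r i) → Fin n)
    (hf : Function.Injective f) (h : Finset.univ.image f ∈ Q.bases i) :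
    IsUnit (Q.tupleCoord f hf) := by
  rw [Q.tupleCoord_of_mem f hf h, Algebra.smul_def]
  exact ((columnSign_ne_zero f hf).isUnit.map _).mul (Q.isUnit_toRRing_X _)

theorem faceHomR_toRRing {P Q : FlagMatroid n r} (hPQ : P.IsFace Q) (f : P.BRing) :
    faceHomR hPQ (P.toRRing f) = Q.toRRing (inclB hPQ f) :=
  P.liftR_toRRing _ _ _ _

theorem faceHomR_tupleCoord {P Q : FlagMatroid n r} (hPQ : P.IsFace Q) (f : Fin (r i) → Fin n)
    (hf : Function.Injective f) (h : Finset.univ.image f ∈ P.bases i) :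
    faceHomR hPQ (P.tupleCoord f hf) = Q.tupleCoord f hf := by
  rw [P.tupleCoord_of_mem f hf h, Q.tupleCoord_of_mem f hf (hPQ.mem_bases h), map_smul,
    faceHomR_toRRing, inclB, MvPolynomial.rename_X]

open Classical in
/-- The affine coordinate of `f` in the chart of `g`: the quotient of alternating coordinates. -/
noncomputable def chartCoord (Q : FlagMatroid n r) (g f : Fin (r i) → Fin n)
    (hg : Function.Injective g) (hf : Function.Injective f) (hgQ : Finset.univ.image g ∈ Q.bases i) :
    Q.coordRing :=
  if h : Finset.univ.image f ∈ Q.bases i then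
    (columnSign f hf * columnSign g hg) •
      Q.ratio ⟨(i, Finset.univ.image f), h⟩ ⟨(i, Finset.univ.image g), hgQ⟩ rfl
  else 0

theorem chartCoord_mul (Q : FlagMatroid n r) (g f : Fin (r i) → Fin n)
    (hg : Function.Injective g) (hf : Function.Injective f)
    (hgQ : Finset.univ.image g ∈ Q.bases i) :
    (Q.chartCoord g f hg hf hgQ : Q.RRing) * Q.tupleCoord g hg = Q.tupleCoord f hf := by
  by_cases h : Finset.univ.image f ∈ Q.bases i
  · rw [chartCoord, dif_pos h, Subalgebra.coe_smul, Q.tupleCoord_of_mem g hg hgQ,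
      Q.tupleCoord_of_mem f hf h, smul_mul_smul_comm, ratio_mul, mul_assoc, columnSign_mul_self,
      mul_one]
  · rw [chartCoord, dif_neg h, Q.tupleCoord_of_notMem f hf h, Subalgebra.coe_zero, zero_mul]

theorem chartCoord_of_notMem (Q : FlagMatroid n r) (g f : Fin (r i) → Fin n)
    (hg : Function.Injective g) (hf : Function.Injective f)
    (hgQ : Finset.univ.image g ∈ Q.bases i) (h : Finset.univ.image f ∉ Q.bases i) :
    Q.chartCoord g f hg hf hgQ = 0 := by
  rw [chartCoord, dif_neg h]

theorem isUnit_chartCoord (Q : FlagMatroid n r) (g f : Fin (r i) → Fin n)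
    (hg : Function.Injective g) (hf : Function.Injective f)
    (hgQ : Finset.univ.image g ∈ Q.bases i) (h : Finset.univ.image f ∈ Q.bases i) :
    IsUnit (Q.chartCoord g f hg hf hgQ) := by
  rw [chartCoord, dif_pos h, Algebra.smul_def]
  exact (((mul_ne_zero (columnSign_ne_zero f hf) (columnSign_ne_zero g hg)).isUnit).map _).mul
    (IsUnit.of_mul_eq_one _ (Q.ratio_mul_ratio _ _ _))

theorem chartCoord_self (Q : FlagMatroid n r) (g : Fin (r i) → Fin n)
    (hg : Function.Injective g) (hgQ : Finset.univ.image g ∈ Q.bases i) :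
    Q.chartCoord g g hg hg hgQ = 1 := by
  apply Subtype.ext
  refine (Q.isUnit_tupleCoord g hg hgQ).mul_left_injective ?_
  beta_reduce
  rw [chartCoord_mul, Subalgebra.coe_one, one_mul]

/-- This compatibility makes the face morphism a coordinate projection. It requires `f` to be a
basis of `P`: otherwise the coordinate is zero on the stratum of `P`, but possibly not on that of
`Q`. -/
theorem faceHom_chartCoord {P Q : FlagMatroid n r} (hPQ : P.IsFace Q) (g f : Fin (r i) → Fin n)
    (hg : Function.Injective g) (hf : Function.Injective f)
    (hgP : Finset.univ.image g ∈ P.bases i) (h : Finset.univ.image f ∈ P.bases i) :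
    faceHom hPQ (P.chartCoord g f hg hf hgP) = Q.chartCoord g f hg hf (hPQ.mem_bases hgP) := by
  apply Subtype.ext
  refine (Q.isUnit_tupleCoord g hg (hPQ.mem_bases hgP)).mul_left_injective ?_
  beta_reduce
  rw [chartCoord_mul, ← faceHomR_tupleCoord hPQ g hg hgP, ← faceHomR_tupleCoord hPQ f hf h,
    ← P.chartCoord_mul g f hg hf hgP, map_mul]
  rfl

end Tuples

end FlagMatroid

/-! ### Plücker coordinates of complete flags in four-space -/

/-- Labels of the Plücker coordinates on `ℙ³ × Gr(2, 4) × ℙ³`, for columns numbered `1, …, 4`. -/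
inductive PluckerLabel
  | p1 | p2 | p3 | p4 | p12 | p13 | p14 | p23 | p24 | p34 | p123 | p124 | p134 | p234
  deriving DecidableEq

namespace PluckerLabel

instance : Fintype PluckerLabel :=
  ⟨{p1, p2, p3, p4, p12, p13, p14, p23, p24, p34, p123, p124, p134, p234}, fun x => by
    cases x <;> decide⟩

/-- The constituent to which a label belongs. -/
def level : PluckerLabel → Fin 3
  | p1 | p2 | p3 | p4 => 0
  | p12 | p13 | p14 | p23 | p24 | p34 => 1
  | p123 | p124 | p134 | p234 => 2

/-- The increasing tuple of the columns of a label, counted from `0`. -/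
def tuple : (l : PluckerLabel) → Fin ((![1, 2, 3] : Fin 3 → ℕ) l.level) → Fin 4
  | p1 => (![0] : Fin 1 → Fin 4)
  | p2 => (![1] : Fin 1 → Fin 4)
  | p3 => (![2] : Fin 1 → Fin 4)
  | p4 => (![3] : Fin 1 → Fin 4)
  | p12 => (![0, 1] : Fin 2 → Fin 4)
  | p13 => (![0, 2] : Fin 2 → Fin 4)
  | p14 => (![0, 3] : Fin 2 → Fin 4)
  | p23 => (![1, 2] : Fin 2 → Fin 4)
  | p24 => (![1, 3] : Fin 2 → Fin 4)
  | p34 => (![2, 3] : Fin 2 → Fin 4)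
  | p123 => (![0, 1, 2] : Fin 3 → Fin 4)
  | p124 => (![0, 1, 3] : Fin 3 → Fin 4)
  | p134 => (![0, 2, 3] : Fin 3 → Fin 4)
  | p234 => (![1, 2, 3] : Fin 3 → Fin 4)

theorem tuple_injective (l : PluckerLabel) : Function.Injective l.tuple := by
  cases l <;> decide

theorem exists_label (i : Fin 3) (S : Finset (Fin 4)) (hS : S.card = (![1, 2, 3] : Fin 3 → ℕ) i) :
    ∃ l : PluckerLabel, l.level = i ∧ Finset.univ.image l.tuple = S := by
  revert i S
  decide

/-- The minor on the first two rows and two columns. -/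
def minorTwo {A : Type*} [CommRing A] (M : Matrix (Fin 4) (Fin 4) A) (a b : Fin 4) : A :=
  M 0 a * M 1 b - M 0 b * M 1 a

/-- The minor on the first three rows and three columns. -/
def minorThree {A : Type*} [CommRing A] (M : Matrix (Fin 4) (Fin 4) A) (a b c : Fin 4) : A :=
  M 0 a * M 1 b * M 2 c - M 0 a * M 1 c * M 2 b - M 0 b * M 1 a * M 2 c +
    M 0 b * M 1 c * M 2 a + M 0 c * M 1 a * M 2 b - M 0 c * M 1 b * M 2 a

/-- The initial minors, written out. -/
def minor {A : Type*} [CommRing A] (M : Matrix (Fin 4) (Fin 4) A) : PluckerLabel → A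
  | p1 => M 0 0
  | p2 => M 0 1
  | p3 => M 0 2
  | p4 => M 0 3
  | p12 => minorTwo M 0 1
  | p13 => minorTwo M 0 2
  | p14 => minorTwo M 0 3
  | p23 => minorTwo M 1 2
  | p24 => minorTwo M 1 3
  | p34 => minorTwo M 2 3
  | p123 => minorThree M 0 1 2
  | p124 => minorThree M 0 1 3
  | p134 => minorThree M 0 2 3
  | p234 => minorThree M 1 2 3

theorem det_submatrix_tuple {A : Type*} [CommRing A] (M : Matrix (Fin 4) (Fin 4) A)
    (l : PluckerLabel) (h : (![1, 2, 3] : Fin 3 → ℕ) l.level ≤ 4) :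
    (M.submatrix (Fin.castLE h) l.tuple).det = minor M l := by
  cases l
  case p1 | p2 | p3 | p4 => exact Matrix.det_fin_one _
  case p12 | p13 | p14 | p23 | p24 | p34 => exact Matrix.det_fin_two _
  case p123 | p124 | p134 | p234 => exact Matrix.det_fin_three _

end PluckerLabel

/-- The initial segment of columns as a tuple. -/
def initialTuple (i : Fin 3) : Fin ((![1, 2, 3] : Fin 3 → ℕ) i) → Fin 4 :=
  Fin.castLE (by revert i; decide)

theorem initialTuple_injective (i : Fin 3) : Function.Injective (initialTuple i) :=
  Fin.castLE_injective _

/-- Affine coordinates on the chart of the flag variety of `ℂ⁴` around the standard flag. -/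
inductive ChartCoord
  | x2 | x3 | x4 | u3 | u4 | w4
  deriving DecidableEq

namespace ChartCoord

open PluckerLabel in
/-- The Plücker coordinate that is used as an affine coordinate. -/
def label : ChartCoord → PluckerLabel
  | x2 => p2
  | x3 => p3
  | x4 => p4
  | u3 => p13
  | u4 => p14
  | w4 => p124

/-- The flag with given affine coordinates. -/
def matrix {A : Type*} [CommRing A] (x : ChartCoord → A) : Matrix (Fin 4) (Fin 4) A :=
  !![1, x x2, x x3, x x4; 0, 1, x u3, x u4; 0, 0, 1, x w4; 0, 0, 0, 1]

/-- The Plücker coordinates of the flag with given affine coordinates. -/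
def plucker {A : Type*} [CommRing A] (x : ChartCoord → A) : PluckerLabel → A
  | .p1 => 1
  | .p2 => x x2
  | .p3 => x x3
  | .p4 => x x4
  | .p12 => 1
  | .p13 => x u3
  | .p14 => x u4
  | .p23 => x x2 * x u3 - x x3
  | .p24 => x x2 * x u4 - x x4
  | .p34 => x x3 * x u4 - x x4 * x u3
  | .p123 => 1
  | .p124 => x w4
  | .p134 => x u3 * x w4 - x u4
  | .p234 => x x2 * (x u3 * x w4 - x u4) - x x3 * x w4 + x x4

theorem plucker_label {A : Type*} [CommRing A] (x : ChartCoord → A) (i : ChartCoord) :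
    plucker x i.label = x i := by
  cases i <;> rfl

theorem minor_matrix {A : Type*} [CommRing A] (x : ChartCoord → A) (l : PluckerLabel) :
    l.minor (matrix x) = plucker x l := by
  cases l <;>
    simp [PluckerLabel.minor, PluckerLabel.minorTwo, PluckerLabel.minorThree, matrix, plucker]
  all_goals ring

theorem det_matrix {A : Type*} [CommRing A] (x : ChartCoord → A) : (matrix x).det = 1 := by
  rw [Matrix.det_of_isUpperTriangular]
  · simp [Fin.prod_univ_four, matrix]
  · intro i j h
    fin_cases i <;> fin_cases j <;> first | rfl | exact absurd h (by decide)

end ChartCoord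

/-! ### Charts of the strata of complete flags -/

namespace FlagMatroid

open PluckerLabel

/-- The label `l` is a basis of its constituent after renaming the columns by `σ`. -/
def Has (Q : FlagMatroid 4 ![1, 2, 3]) (σ : Equiv.Perm (Fin 4)) (l : PluckerLabel) : Prop :=
  Finset.univ.image (σ ∘ l.tuple) ∈ Q.bases l.level

/-- The standard flag is a flag of bases after renaming the columns by `σ`. -/
def IsChart (Q : FlagMatroid 4 ![1, 2, 3]) (σ : Equiv.Perm (Fin 4)) : Prop :=
  ∀ i, Finset.univ.image (σ ∘ initialTuple i) ∈ Q.bases i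

/-- Each relation is linear in one of `p23, p24, p34, p134, p234`, with coefficient `p1` or `p12`.
Where these are invertible, the relations eliminate every coordinate outside the six affine ones and
the standard flag. -/
theorem tuplePlucker_relations (σ : Equiv.Perm (Fin 4)) :
    let T : PluckerLabel → MvPolynomial (PluckerIndex 4 ![1, 2, 3]) ℂ := fun l =>
      tuplePlucker (i := l.level) (σ ∘ l.tuple) (σ.injective.comp l.tuple_injective)
    (T p1 * T p23 - (T p2 * T p13 - T p3 * T p12) ∈ flagIdeal 4 ![1, 2, 3]) ∧
    (T p1 * T p24 - (T p2 * T p14 - T p4 * T p12) ∈ flagIdeal 4 ![1, 2, 3]) ∧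
    (T p1 * T p34 - (T p3 * T p14 - T p4 * T p13) ∈ flagIdeal 4 ![1, 2, 3]) ∧
    (T p12 * T p134 - (T p13 * T p124 - T p14 * T p123) ∈ flagIdeal 4 ![1, 2, 3]) ∧
    (T p1 * T p234 - (T p2 * T p134 - T p3 * T p124 + T p4 * T p123) ∈
      flagIdeal 4 ![1, 2, 3]) := by
  intro T
  have hT : ∀ p A (c : Fin 3 → ℂˣ) (_ : ∀ x : PluckerIndex 4 ![1, 2, 3],
      p x = c x.1.1 * initialMinor A x.1.2) l,
      MvPolynomial.aeval p (T l) = c l.level * l.minor (A.submatrix id σ) := by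
    intro p A c hp l
    rw [aeval_tuplePlucker _ _ hp, ← det_submatrix_tuple]
    rfl
  refine ⟨?_, ?_, ?_, ?_, ?_⟩ <;> rintro p ⟨A, -, c, hp⟩ <;>
    simp only [map_sub, map_add, map_mul, hT p A c hp, level, minor, minorTwo, minorThree] <;> ring

variable (Q : FlagMatroid 4 ![1, 2, 3]) {σ : Equiv.Perm (Fin 4)}

/-- The normalised Plücker coordinates in the chart `σ`, as functions on the stratum. -/
noncomputable def chartPlucker (hσ : Q.IsChart σ) (l : PluckerLabel) : Q.coordRing :=
  Q.chartCoord (σ ∘ initialTuple l.level) (σ ∘ l.tuple)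
    (σ.injective.comp (initialTuple_injective _)) (σ.injective.comp l.tuple_injective) (hσ l.level)

theorem initialTuple_zero : initialTuple 0 = tuple p1 := by
  refine funext fun (j : Fin 1) => ?_
  fin_cases j; rfl

theorem initialTuple_one : initialTuple 1 = tuple p12 := by
  refine funext fun (j : Fin 2) => ?_
  fin_cases j <;> rfl

theorem initialTuple_two : initialTuple 2 = tuple p123 := by
  refine funext fun (j : Fin 3) => ?_
  fin_cases j <;> rfl

theorem isChart_iff : Q.IsChart σ ↔ Q.Has σ p1 ∧ Q.Has σ p12 ∧ Q.Has σ p123 := by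
  have h1 : Q.Has σ p1 ↔ Finset.univ.image (σ ∘ initialTuple 0) ∈ Q.bases 0 := by
    rw [initialTuple_zero]; rfl
  have h2 : Q.Has σ p12 ↔ Finset.univ.image (σ ∘ initialTuple 1) ∈ Q.bases 1 := by
    rw [initialTuple_one]; rfl
  have h3 : Q.Has σ p123 ↔ Finset.univ.image (σ ∘ initialTuple 2) ∈ Q.bases 2 := by
    rw [initialTuple_two]; rfl
  rw [h1, h2, h3]
  simp only [IsChart, Fin.forall_fin_succ, IsEmpty.forall_iff, and_true]
  rfl

theorem chartCoord_eq_one {i : Fin 3} (g f : Fin ((![1, 2, 3] : Fin 3 → ℕ) i) → Fin 4)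
    (hg : Function.Injective g) (hf : Function.Injective f)
    (hgQ : Finset.univ.image g ∈ Q.bases i) (h : g = f) : Q.chartCoord g f hg hf hgQ = 1 := by
  subst h
  exact Q.chartCoord_self g hg hgQ

theorem chartPlucker_p1 (hσ : Q.IsChart σ) : Q.chartPlucker hσ p1 = 1 :=
  Q.chartCoord_eq_one _ _ _ _ _ (congrArg (σ ∘ ·) initialTuple_zero)

theorem chartPlucker_p12 (hσ : Q.IsChart σ) : Q.chartPlucker hσ p12 = 1 :=
  Q.chartCoord_eq_one _ _ _ _ _ (congrArg (σ ∘ ·) initialTuple_one)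

theorem chartPlucker_p123 (hσ : Q.IsChart σ) : Q.chartPlucker hσ p123 = 1 :=
  Q.chartCoord_eq_one _ _ _ _ _ (congrArg (σ ∘ ·) initialTuple_two)

theorem chartPlucker_eq_plucker (hσ : Q.IsChart σ) (l : PluckerLabel) :
    Q.chartPlucker hσ l = ChartCoord.plucker (fun i => Q.chartPlucker hσ i.label) l := by
  have hinj : ∀ i, Function.Injective (σ ∘ initialTuple i) := fun i =>
    σ.injective.comp (initialTuple_injective i)
  let g : Fin 3 → Q.RRing := fun i => Q.tupleCoord (i := i) (σ ∘ initialTuple i) (hinj i)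
  have hg : ∀ i, IsUnit (g i) := fun i => Q.isUnit_tupleCoord _ (hinj i) (hσ i)
  let T : PluckerLabel → MvPolynomial (PluckerIndex 4 ![1, 2, 3]) ℂ := fun l =>
      tuplePlucker (i := l.level) (σ ∘ l.tuple) (σ.injective.comp l.tuple_injective)
  have hT : ∀ l, Q.pluckerHom (T l) = Q.chartPlucker hσ l * g l.level := fun l =>
    (Q.chartCoord_mul _ _ _ _ _).symm
  obtain ⟨h1, h2, h3, h4, h5⟩ := tuplePlucker_relations σ
  have e1 := Q.pluckerHom_eq_zero_of_flagIdeal h1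
  have e2 := Q.pluckerHom_eq_zero_of_flagIdeal h2
  have e3 := Q.pluckerHom_eq_zero_of_flagIdeal h3
  have e4 := Q.pluckerHom_eq_zero_of_flagIdeal h4
  have e5 := Q.pluckerHom_eq_zero_of_flagIdeal h5
  change Q.pluckerHom (T p1 * T p23 - (T p2 * T p13 - T p3 * T p12)) = 0 at e1
  change Q.pluckerHom (T p1 * T p24 - (T p2 * T p14 - T p4 * T p12)) = 0 at e2
  change Q.pluckerHom (T p1 * T p34 - (T p3 * T p14 - T p4 * T p13)) = 0 at e3
  change Q.pluckerHom (T p12 * T p134 - (T p13 * T p124 - T p14 * T p123)) = 0 at e4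
  change Q.pluckerHom (T p1 * T p234 - (T p2 * T p134 - T p3 * T p124 + T p4 * T p123)) = 0 at e5
  simp only [map_sub, map_add, map_mul, hT, level, chartPlucker_p1, chartPlucker_p12,
    chartPlucker_p123, Subalgebra.coe_one, one_mul] at e1 e2 e3 e4 e5
  -- The relations hold up to the homogeneous scalars `g i`, which are units and get cancelled. The
  -- formula for `p134` comes first because the one for `p234` contains it.
  have f4 : Q.chartPlucker hσ p134 = Q.chartPlucker hσ p13 * Q.chartPlucker hσ p124 -
      Q.chartPlucker hσ p14 := by
    refine Subtype.ext (((hg 1).mul (hg 2)).mul_left_injective ?_)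
    simp only [Subalgebra.coe_sub, Subalgebra.coe_mul]
    linear_combination e4
  cases l
  case p1 => exact Q.chartPlucker_p1 hσ
  case p12 => exact Q.chartPlucker_p12 hσ
  case p123 => exact Q.chartPlucker_p123 hσ
  case p2 | p3 | p4 | p13 | p14 | p124 => rfl
  case p134 => exact f4
  case p234 =>
    simp only [ChartCoord.plucker, ChartCoord.label]
    rw [← f4]
    refine Subtype.ext (((hg 0).mul (hg 2)).mul_left_injective ?_)
    simp only [Subalgebra.coe_sub, Subalgebra.coe_mul, Subalgebra.coe_add]
    linear_combination e5
  all_goals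
    simp only [ChartCoord.plucker, ChartCoord.label]
    refine Subtype.ext (((hg 0).mul (hg 1)).mul_left_injective ?_)
    simp only [Subalgebra.coe_sub, Subalgebra.coe_mul]
    first
    | linear_combination e1
    | linear_combination e2
    | linear_combination e3

theorem isUnit_chartPlucker (hσ : Q.IsChart σ) {l : PluckerLabel} (h : Q.Has σ l) :
    IsUnit (Q.chartPlucker hσ l) :=
  Q.isUnit_chartCoord _ _ _ _ _ h

theorem chartPlucker_eq_zero (hσ : Q.IsChart σ) {l : PluckerLabel} (h : ¬ Q.Has σ l) :
    Q.chartPlucker hσ l = 0 :=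
  Q.chartCoord_of_notMem _ _ _ _ _ h

theorem Has.mono {P Q : FlagMatroid 4 ![1, 2, 3]} (hPQ : P.IsFace Q) {l : PluckerLabel}
    (h : P.Has σ l) : Q.Has σ l := hPQ.mem_bases h

theorem IsChart.mono {P Q : FlagMatroid 4 ![1, 2, 3]} (hPQ : P.IsFace Q) (h : P.IsChart σ) :
    Q.IsChart σ := fun i => hPQ.mem_bases (h i)

theorem faceHom_chartPlucker {P Q : FlagMatroid 4 ![1, 2, 3]} (hPQ : P.IsFace Q)
    (hσ : P.IsChart σ) {l : PluckerLabel} (h : P.Has σ l) :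
    faceHom hPQ (P.chartPlucker hσ l) = Q.chartPlucker (hσ.mono hPQ) l :=
  faceHom_chartCoord hPQ _ _ _ _ _ h

theorem exists_label_of_card (σ : Equiv.Perm (Fin 4)) (i : Fin 3) (S : Finset (Fin 4))
    (hS : S.card = (![1, 2, 3] : Fin 3 → ℕ) i) :
    ∃ l : PluckerLabel, l.level = i ∧ Finset.univ.image (σ ∘ l.tuple) = S := by
  obtain ⟨l, h1, h2⟩ := PluckerLabel.exists_label i (S.image σ.symm)
    (by rw [Finset.card_image_of_injective _ σ.symm.injective, hS])
  refine ⟨l, h1, ?_⟩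
  rw [← Finset.image_image, h2, Finset.image_image]
  simp

theorem ratGenerates_chartPlucker (hσ : Q.IsChart σ) :
    RatGenerates ℂ (Set.range fun i : ChartCoord => Q.chartPlucker hσ i.label) := by
  intro L hL hS
  have hmem : ∀ i : ChartCoord, Q.chartPlucker hσ i.label ∈ L := fun i => hS ⟨i, rfl⟩
  have hmem' : ∀ l, Q.chartPlucker hσ l ∈ L := by
    intro l
    rw [chartPlucker_eq_plucker]
    cases l <;> simp only [ChartCoord.plucker] <;>
      repeat' first
        | exact hmem _
        | exact L.one_mem
        | apply L.sub_mem
        | apply L.add_mem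
        | apply L.mul_mem
  refine Q.ratGenerates_ratio (fun i => ⟨(i, Finset.univ.image (σ ∘ initialTuple i)), hσ i⟩)
    (fun i => rfl) L hL ?_
  rintro _ ⟨⟨⟨i, S⟩, hS⟩, rfl⟩
  obtain ⟨l, rfl, rfl⟩ := exists_label_of_card σ i S (Q.card_of_mem_bases hS)
  have h := hmem' l
  rw [chartPlucker, chartCoord, dif_pos hS] at h
  have hne := mul_ne_zero (columnSign_ne_zero _ (σ.injective.comp l.tuple_injective))
    (columnSign_ne_zero _ (σ.injective.comp (initialTuple_injective l.level)))
  have := L.smul_mem h (columnSign _ (σ.injective.comp l.tuple_injective) *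
    columnSign _ (σ.injective.comp (initialTuple_injective l.level)))⁻¹
  rwa [smul_smul, inv_mul_cancel₀ hne, one_smul] at this

/-- Every flag in the chart with the right vanishing pattern is a complex point of the stratum. -/
theorem exists_algHom_chartPlucker (hσ : Q.IsChart σ) (x : ChartCoord → ℂ)
    (hx : ∀ l, ChartCoord.plucker x l ≠ 0 ↔ Q.Has σ l) :
    ∃ χ : Q.coordRing →ₐ[ℂ] ℂ, ∀ i : ChartCoord, χ (Q.chartPlucker hσ i.label) = x i := by
  -- The columns are permuted back, so that the chart `σ` sees the unipotent matrix with the given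
  -- coordinates.
  let A := (ChartCoord.matrix x).submatrix id σ.symm
  have hA : A.submatrix id σ = ChartCoord.matrix x := by
    ext i j
    simp [A]
  have hdet : A.det ≠ 0 := by
    have : (A.submatrix id σ).det = 1 := by rw [hA, ChartCoord.det_matrix]
    rw [Matrix.det_permute'] at this
    exact right_ne_zero_of_mul_eq_one this
  let p : PluckerIndex 4 ![1, 2, 3] → ℂ := fun y => initialMinor A y.1.2
  have hp : ∀ y : PluckerIndex 4 ![1, 2, 3], p y = ((1 : Fin 3 → ℂˣ) y.1.1 : ℂ) *
      initialMinor A y.1.2 := fun y => by simp [p]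
  have hT : ∀ l : PluckerLabel, columnSign _ (σ.injective.comp l.tuple_injective) *
      initialMinor A (Finset.univ.image (σ ∘ l.tuple)) = ChartCoord.plucker x l := by
    intro l
    rw [columnSign_mul_initialMinor, ← ChartCoord.minor_matrix, ← hA, ← det_submatrix_tuple _ _
        (by cases l <;> decide)]
    rfl
  obtain ⟨χ, hχ⟩ := Q.exists_algHom_of_mem_flagCone (p := p) ⟨A, hdet, 1, hp⟩ (by
    rintro ⟨⟨i, S⟩, hS⟩
    obtain ⟨l, rfl, rfl⟩ := exists_label_of_card σ i S hS
    refine Iff.trans ?_ (hx l)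
    rw [← hT l]
    simp only [p, mul_ne_zero_iff, columnSign_ne_zero, ne_eq, not_false_eq_true, true_and])
  refine ⟨χ.comp Q.coordRing.val, fun i => ?_⟩
  have key : ∀ l : PluckerLabel, χ (Q.pluckerHom (tuplePlucker (i := l.level) (σ ∘ l.tuple)
      (σ.injective.comp l.tuple_injective))) = ChartCoord.plucker x l := by
    intro l
    rw [hχ, tuplePlucker, map_mul, MvPolynomial.aeval_C, MvPolynomial.aeval_X, ← hT]
    rfl
  have hone : ∀ i : Fin 3, χ (Q.tupleCoord (i := i) (σ ∘ initialTuple i)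
      (σ.injective.comp (initialTuple_injective i))) = 1 := by
    intro i
    have h1 : (A.submatrix (Fin.castLE (le_of_injective_fin
        (σ.injective.comp (initialTuple_injective i)))) (σ ∘ initialTuple i)).det =
        ((ChartCoord.matrix x).submatrix (Fin.castLE (le_of_injective_fin
        (σ.injective.comp (initialTuple_injective i)))) (initialTuple i)).det := by
      rw [← hA]
      rfl
    rw [tupleCoord, hχ, tuplePlucker, map_mul, MvPolynomial.aeval_C, MvPolynomial.aeval_X]
    refine (columnSign_mul_initialMinor _
      (σ.injective.comp (initialTuple_injective i)) A).trans (h1.trans ?_)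
    fin_cases i
    · exact (Matrix.det_fin_one _).trans (by simp [ChartCoord.matrix, initialTuple])
    · exact (Matrix.det_fin_two _).trans (by simp [ChartCoord.matrix, initialTuple])
    · exact (Matrix.det_fin_three _).trans (by simp [ChartCoord.matrix, initialTuple])
  have h1 := congrArg χ (Q.chartCoord_mul (σ ∘ initialTuple i.label.level) (σ ∘ i.label.tuple)
    (σ.injective.comp (initialTuple_injective _)) (σ.injective.comp i.label.tuple_injective)
    (hσ i.label.level))
  rw [map_mul, hone, mul_one] at h1
  exact h1.trans ((key i.label).trans (ChartCoord.plucker_label x i))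

end FlagMatroid

/-! ### Generic numbers with prescribed vanishing -/

/-- Not exactly one of three statements holds: the vanishing pattern of three numbers with zero
sum. -/
def NotExactlyOne (a b c : Prop) : Prop :=
  (a → b ∨ c) ∧ (b → a ∨ c) ∧ (c → a ∨ b)

theorem Subalgebra.InvClosed.mem_of_mul_mem {R A : Type*} [CommRing R] [CommRing A] [Algebra R A]
    {L : Subalgebra R A} (hL : L.InvClosed) {a b : A} (ha : a ∈ L) (hu : IsUnit a)
    (hab : a * b ∈ L) : b ∈ L := by
  obtain ⟨c, hc⟩ := hu.exists_right_inv
  have := L.mul_mem (hL a c ha hc) hab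
  rwa [← mul_assoc, mul_comm c, hc, one_mul] at this

/-- Generic numbers with prescribed vanishing among `x, y, z, x * y - z`, where `y` is the dependent
one. -/
theorem exists_three_term {a b c d : Prop} (h : NotExactlyOne (a ∧ b) c d) {s t w : ℂ} (hs : s ≠ 0)
    (ht : t ≠ 0) (hw : w ≠ 0) (hstw : s * t - w ≠ 0) : ∃ x y z : ℂ, (x ≠ 0 ↔ a) ∧ (y ≠ 0 ↔ b) ∧
      (z ≠ 0 ↔ c) ∧ (x * y - z ≠ 0 ↔ d) ∧ (a → x = s) ∧ (b ∧ ¬(a ∧ ¬d) → y = t) ∧ (c → z = w) ∧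
      (x = 0 ∨ x = s) ∧ (z = 0 ∨ z = w) ∧ (y = 0 ∨ y = t ∨ x ≠ 0 ∧ x * y = z) := by
  obtain ⟨h1, h2, h3⟩ := h
  -- The hypothesis rules out seven of the sixteen cases. In the rest each number is zero or its
  -- generic value, except that `y` must be `w / s` when `a, b, c` hold and `d` fails.
  by_cases ha : a <;> by_cases hb : b <;> by_cases hc : c <;> by_cases hd : d <;>
    simp only [ha, hb, hc, hd, and_true, and_false, true_and, or_false, or_true, forall_const,
      imp_false, not_true_eq_false, not_false_eq_true, IsEmpty.forall_iff] at h1 h2 h3 ⊢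
  · exact ⟨s, t, w, by simp [*]⟩
  · exact ⟨s, w / s, w, by simp [*, mul_div_cancel₀]⟩
  · exact ⟨s, t, 0, by simp [*]⟩
  · exact ⟨s, 0, w, by simp [*]⟩
  · exact ⟨s, 0, 0, by simp [*]⟩
  · exact ⟨0, t, w, by simp [*]⟩
  · exact ⟨0, t, 0, by simp [*]⟩
  · exact ⟨0, 0, w, by simp [*]⟩
  · exact ⟨0, 0, 0, by simp [*]⟩

/-- Generic numbers with prescribed vanishing among `x, y, z, x * y - z`, where `z` is the dependent
one. -/
theorem exists_three_term' {a b c d : Prop} (h : NotExactlyOne (a ∧ b) c d) {s t w : ℂ} (hs : s ≠ 0)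
    (ht : t ≠ 0) (hw : w ≠ 0) (hstw : s * t - w ≠ 0) : ∃ x y z : ℂ, (x ≠ 0 ↔ a) ∧ (y ≠ 0 ↔ b) ∧
      (z ≠ 0 ↔ c) ∧ (x * y - z ≠ 0 ↔ d) ∧ (a → x = s) ∧ (b → y = t) ∧
      (c ∧ ¬(a ∧ b ∧ ¬d) → z = w) ∧
      (x = 0 ∨ x = s) ∧ (y = 0 ∨ y = t) ∧ (z = 0 ∨ z = w ∨ x * y = z) := by
  obtain ⟨h1, h2, h3⟩ := h
  -- The same nine cases remain; now `z = s * t` is the value forced when `a, b, c` hold and `d`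
  -- fails.
  by_cases ha : a <;> by_cases hb : b <;> by_cases hc : c <;> by_cases hd : d <;>
    simp only [ha, hb, hc, hd, and_true, and_false, true_and, or_false, or_true, forall_const,
      imp_false, not_true_eq_false, not_false_eq_true, IsEmpty.forall_iff] at h1 h2 h3 ⊢
  · exact ⟨s, t, w, by simp [*]⟩
  · exact ⟨s, t, s * t, by simp [*]⟩
  · exact ⟨s, t, 0, by simp [*]⟩
  · exact ⟨s, 0, w, by simp [*]⟩
  · exact ⟨s, 0, 0, by simp [*]⟩
  · exact ⟨0, t, w, by simp [*]⟩
  · exact ⟨0, t, 0, by simp [*]⟩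
  · exact ⟨0, 0, w, by simp [*]⟩
  · exact ⟨0, 0, 0, by simp [*]⟩

/-- Generic numbers `u, x` with prescribed vanishing among `u, x, p * u - x, x * r - q * u`. -/
theorem exists_two_forms {a b e f : Prop} {p q r : ℂ} (h1 : NotExactlyOne (p ≠ 0 ∧ a) b e)
    (h2 : NotExactlyOne (b ∧ r ≠ 0) (q ≠ 0 ∧ a) f)
    (h3 : NotExactlyOne (a ∧ p * r - q ≠ 0) (r ≠ 0 ∧ e) f)
    {s t : ℂ} (hs : s ≠ 0)
    (ht : t ≠ 0) (hst : p * s - t ≠ 0) (hqr : q ≠ 0 ∨ r ≠ 0 → t * r - q * s ≠ 0) :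
    ∃ u x : ℂ, (u ≠ 0 ↔ a) ∧ (x ≠ 0 ↔ b) ∧ (p * u - x ≠ 0 ↔ e) ∧ (x * r - q * u ≠ 0 ↔ f) ∧
      (a → u = s) ∧ (b ∧ ¬(a ∧ ¬e) ∧ ¬(a ∧ ¬f ∧ r ≠ 0) → x = t) := by
  obtain ⟨h11, h12, h13⟩ := h1
  obtain ⟨h21, h22, h23⟩ := h2
  obtain ⟨h31, h32, h33⟩ := h3
  by_cases ha : a
  · by_cases he : e
    · by_cases hf : f
      · by_cases hb : b
        · exact ⟨s, t, by simp [ha, hs], by simp [hb, ht], by simp [he, hst],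
            by simp [hf, hqr (show q ≠ 0 ∨ r ≠ 0 by grind)],
            fun _ => rfl, fun _ => rfl⟩
        · have hp : p ≠ 0 := by grind
          have hq : q ≠ 0 := by grind
          exact ⟨s, 0, by simp [*], by simp [*], by simp [*], by simp [*], fun _ => rfl, by grind⟩
      · by_cases hr : r = 0
        · have hq : q = 0 := by grind
          by_cases hb : b
          · exact ⟨s, t, by simp [*], by simp [*], by simp [*], by simp [*], fun _ => rfl,
              fun _ => rfl⟩
          · have hp : p ≠ 0 := by grind
            exact ⟨s, 0, by simp [*], by simp [*], by simp [*], by simp [*], fun _ => rfl, by grind⟩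
        · have hD : p * r - q ≠ 0 := by grind
          have hbq : q ≠ 0 ↔ b := by grind
          -- The failure of `f` with `r ≠ 0` determines `x` by `x * r = q * u`; then `p * u - x` is
          -- a nonzero multiple of `p * r - q`.
          refine ⟨s, q * s / r, by simp [*], ?_, ?_, ?_, fun _ => rfl, by grind⟩
          · simp [← hbq, hr, hs]
          · have : p * s - q * s / r = (p * r - q) * s / r := by field_simp
            rw [this]
            simp [*]
          · rw [div_mul_cancel₀ _ hr, sub_self]
            simp [hf]
    · have hp : p ≠ 0 ↔ b := by grind
      have hD : p * r - q ≠ 0 ↔ f := by grind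
      -- The failure of `e` forces `x = p * u`; the last form becomes `(p * r - q) * u`.
      refine ⟨s, p * s, by simp [*], ?_, by simp [he], ?_, fun _ => rfl, by grind⟩
      · simp [← hp, hs]
      · have : p * s * r - q * s = (p * r - q) * s := by ring
        rw [this, mul_ne_zero_iff, hD]
        simp [hs]
  · by_cases hb : b
    · have hf : r ≠ 0 ↔ f := by grind
      have he : e := by grind
      exact ⟨0, t, by simp [*], by simp [*], by simp [*], by simp [← hf, ht], by grind, fun _ => rfl⟩
    · have he : ¬ e := by grind
      have hf : ¬ f := by grind
      exact ⟨0, 0, by simp [*], by simp [*], by simp [*], by simp [*], by grind, by grind⟩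

/-- Generic `2 × 3` matrices with prescribed vanishing entries and minors, after a column of units. -/
theorem exists_two_rows {a b c d a' b' e f : Prop} (h0 : NotExactlyOne (a ∧ b) c d)
    (h1 : NotExactlyOne (a ∧ a') b' e) (h2 : NotExactlyOne (b' ∧ b) (c ∧ a') f)
    (h3 : NotExactlyOne (a' ∧ d) (b ∧ e) f) {s t w s' t' : ℂ} (hs : s ≠ 0) (ht : t ≠ 0)
    (hw : w ≠ 0) (hs' : s' ≠ 0) (ht' : t' ≠ 0) (hstw : s * t - w ≠ 0) (hst : s * s' - t' ≠ 0)
    (htw : t' * t - w * s' ≠ 0) : ∃ x y z u v : ℂ, (x ≠ 0 ↔ a) ∧ (y ≠ 0 ↔ b) ∧ (z ≠ 0 ↔ c) ∧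
      (x * y - z ≠ 0 ↔ d) ∧ (u ≠ 0 ↔ a') ∧ (v ≠ 0 ↔ b') ∧ (x * u - v ≠ 0 ↔ e) ∧
      (v * y - z * u ≠ 0 ↔ f) ∧ (a → x = s) ∧ (b ∧ ¬(a ∧ ¬d) → y = t) ∧ (c → z = w) ∧
      (a' → u = s') ∧ (b' ∧ ¬(a' ∧ ¬e) ∧ ¬(a' ∧ ¬f ∧ b) → v = t') := by
  obtain ⟨x, y, z, hx, hy, hz, hd, ex, ey, ez, gx, gz, gy⟩ := exists_three_term h0 hs ht hw hstw
  have hp : x * s' - t' ≠ 0 := by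
    rcases gx with rfl | rfl
    · simpa using ht'
    · exact hst
  -- The genericity of `s', t'` has to survive the specialization of `x, y, z`. If `z = x * y`, the
  -- determinant factors as `-y * (x * s' - t')`, which reduces it to `hp`.
  have hqr : z ≠ 0 ∨ y ≠ 0 → t' * y - z * s' ≠ 0 := by
    rcases gy with rfl | rfl | ⟨-, rfl⟩
    · intro h
      simpa [hs'] using h
    · rcases gz with rfl | rfl
      · simp [ht, ht']
      · exact fun _ => htw
    · intro h
      have h1 : y ≠ 0 := by rintro rfl; simp at h
      rw [show t' * y - x * y * s' = -y * (x * s' - t') by ring]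
      exact mul_ne_zero (neg_ne_zero.mpr h1) hp
  obtain ⟨u, v, hu, hv, he, hf, eu, ev⟩ := exists_two_forms (p := x) (q := z) (r := y)
    (by rw [hx]; exact h1) (by rw [hy, hz]; exact h2) (by rw [hd, hy]; exact h3) hs' ht' hp hqr
  rw [hy] at ev
  exact ⟨x, y, z, u, v, hx, hy, hz, hd, hu, hv, he, hf, ex, ey, ez, eu, ev⟩

/-! ### Vanishing patterns and coordinate systems -/

open PluckerLabel ChartCoord

/-- Conditions on the vanishing pattern in a chart that hold for all flag matroids. -/
structure IsFlagPattern (h : PluckerLabel → Prop) : Prop where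
  rel_p1 : h p1
  rel_p12 : h p12
  rel_p123 : h p123
  rel_p23 : NotExactlyOne (h p2 ∧ h p13) (h p3) (h p23)
  rel_p24 : NotExactlyOne (h p2 ∧ h p14) (h p4) (h p24)
  rel_p34 : NotExactlyOne (h p3 ∧ h p14) (h p4 ∧ h p13) (h p34)
  rel_p34' : NotExactlyOne (h p13 ∧ h p24) (h p14 ∧ h p23) (h p34)
  rel_p134 : NotExactlyOne (h p124 ∧ h p13) (h p14) (h p134)
  rel_line2 : NotExactlyOne (h p23 ∧ h p124) (h p24) (h p234)
  rel_line3 : NotExactlyOne (h p13 ∧ h p234) (h p23 ∧ h p134) (h p34)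
  rel_quad_p4 : h p4 → (h p2 ∧ h p134) ∨ (h p3 ∧ h p124) ∨ h p234
  rel_quad_p234 : h p234 → (h p2 ∧ h p134) ∨ (h p3 ∧ h p124) ∨ h p4
  rel_quad_p3 : h p3 ∧ h p124 → (h p2 ∧ h p134) ∨ h p234 ∨ h p4

/-- Generic coordinates. -/
structure IsGeneric (τ : ChartCoord → ℂ) : Prop where
  ne_zero : ∀ i, τ i ≠ 0
  p23 : τ x2 * τ u3 - τ x3 ≠ 0
  p24 : τ x2 * τ u4 - τ x4 ≠ 0
  p34 : τ x3 * τ u4 - τ x4 * τ u3 ≠ 0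
  p134 : τ w4 * τ u3 - τ u4 ≠ 0
  p234 : τ w4 * τ x3 - τ x4 ≠ 0
  sum : τ x2 * τ u4 - τ x4 + τ x3 * τ w4 ≠ 0
  sum' : τ x2 * τ u4 + τ x3 * τ w4 ≠ 0

/-- Packing the open conditions into one nonzero polynomial lets them be imposed together with the
nonvanishing of any further nonzero polynomial. -/
theorem exists_isGeneric : ∃ G : MvPolynomial ChartCoord ℂ, G ≠ 0 ∧
    ∀ τ, MvPolynomial.aeval τ G ≠ 0 → IsGeneric τ := by
  let X : ChartCoord → MvPolynomial ChartCoord ℂ := MvPolynomial.X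
  refine ⟨X x2 * X x3 * X x4 * X u3 * X u4 * X w4 * (X x2 * X u3 - X x3) * (X x2 * X u4 - X x4) *
    (X x3 * X u4 - X x4 * X u3) * (X w4 * X u3 - X u4) * (X w4 * X x3 - X x4) *
    (X x2 * X u4 - X x4 + X x3 * X w4) * (X x2 * X u4 + X x3 * X w4), fun h => ?_, fun τ h => ?_⟩
  · have := congrArg (MvPolynomial.aeval fun i : ChartCoord => (match i with
      | x2 => 2 | x3 => 3 | x4 => 5 | u3 => 7 | u4 => 11 | w4 => 13 : ℂ)) h
    simp only [map_mul, map_sub, map_add, X, MvPolynomial.aeval_X, map_zero] at this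
    norm_num at this
  · simp only [map_mul, map_sub, map_add, X, MvPolynomial.aeval_X, mul_ne_zero_iff] at h
    exact ⟨fun i => by cases i <;> tauto, by tauto, by tauto, by tauto, by tauto, by tauto, by tauto,
      by tauto⟩

/-- The coordinates in `I` are independent and generate, for every stratum with pattern `h`. -/
structure IsCoordSystem (h : PluckerLabel → Prop) (I : Set ChartCoord) : Prop where
  mem : ∀ {A : Type} [CommRing A] [Algebra ℂ A] (x : ChartCoord → A),
    (∀ l, h l → IsUnit (plucker x l)) → (∀ l, ¬ h l → plucker x l = 0) →
    ∀ L : Subalgebra ℂ A, L.InvClosed → (∀ i ∈ I, x i ∈ L) → ∀ i, x i ∈ L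
  exists_of_isGeneric : ∀ τ, IsGeneric τ →
    ∃ x : ChartCoord → ℂ, (∀ l, plucker x l ≠ 0 ↔ h l) ∧ ∀ i ∈ I, x i = τ i

namespace FlagMatroid

theorem isSmoothConnected_faceHom {P Q : FlagMatroid 4 ![1, 2, 3]} (hPQ : P.IsFace Q)
    {σ : Equiv.Perm (Fin 4)} (hσ : P.IsChart σ) {I I' : Set ChartCoord} (hI : I ⊆ I')
    (hP : IsCoordSystem (P.Has σ) I) (hQ : IsCoordSystem (Q.Has σ) I') :
    (faceHom hPQ).toRingHom.IsSmoothConnected := by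
  obtain ⟨G, hG0, hG⟩ := exists_isGeneric
  have hgen : ∀ {Q : FlagMatroid 4 ![1, 2, 3]} (hσ : Q.IsChart σ) {I : Set ChartCoord},
      IsCoordSystem (Q.Has σ) I →
      RatGenerates ℂ ((fun i : ChartCoord => Q.chartPlucker hσ i.label) '' I) := by
    intro Q hσ I hQ L hL hS
    refine Q.ratGenerates_chartPlucker hσ L hL ?_
    rintro _ ⟨i, rfl⟩
    refine hQ.mem (fun i => Q.chartPlucker hσ i.label) (fun l hl => ?_) (fun l hl => ?_) L hL
      (fun i hi => hS ⟨i, hi, rfl⟩) i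
    · rw [← Q.chartPlucker_eq_plucker hσ]; exact Q.isUnit_chartPlucker hσ hl
    · rw [← Q.chartPlucker_eq_plucker hσ]; exact Q.chartPlucker_eq_zero hσ hl
  refine isSmoothConnected_of_coords (faceHom hPQ)
    (yB := fun i : ChartCoord => P.chartPlucker hσ i.label)
    (yA := fun i : ChartCoord => Q.chartPlucker (hσ.mono hPQ) i.label) hI (fun i hi => ?_)
    (hgen hσ hP) (hgen _ hQ) ?_
  · apply faceHom_chartPlucker
    -- A coordinate in `I` takes a generic, hence nonzero, value at some point with the pattern of
    -- `P`, so its label is a basis of `P`.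
    obtain ⟨τ, hτ⟩ : ∃ τ : ChartCoord → ℂ, MvPolynomial.aeval τ G ≠ 0 := by
      by_contra! h
      exact hG0 (MvPolynomial.funext fun τ => by simpa [MvPolynomial.aeval_eq_eval] using h τ)
    obtain ⟨x, hx, hxτ⟩ := hP.exists_of_isGeneric τ (hG τ hτ)
    rw [← hx, plucker_label, hxτ i hi]
    exact (hG τ hτ).ne_zero i
  · rw [AlgebraicIndependent, injective_iff_map_eq_zero]
    intro f hf
    by_contra hf0
    have hf1 : MvPolynomial.rename ((↑) : I' → ChartCoord) f ≠ 0 := fun e =>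
      hf0 (MvPolynomial.rename_injective _ Subtype.val_injective (e.trans (map_zero _).symm))
    -- A relation `f` among the coordinates would vanish at every complex point of the stratum, but
    -- a generic `τ` with `f(τ) ≠ 0` extends to such a point.
    obtain ⟨τ, hτ⟩ : ∃ τ : ChartCoord → ℂ, MvPolynomial.aeval τ (MvPolynomial.rename ((↑) : I' → ChartCoord) f * G)
        ≠ 0 := by
      by_contra! h
      exact mul_ne_zero hf1 hG0
        (MvPolynomial.funext fun τ => by simpa [MvPolynomial.aeval_eq_eval] using h τ)
    rw [map_mul] at hτ
    obtain ⟨x, hx, hxτ⟩ := hQ.exists_of_isGeneric τ (hG τ (right_ne_zero_of_mul hτ))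
    obtain ⟨χ, hχ⟩ := Q.exists_algHom_chartPlucker (hσ.mono hPQ) x hx
    apply left_ne_zero_of_mul hτ
    rw [MvPolynomial.aeval_rename]
    have e1 : τ ∘ ((↑) : I' → ChartCoord) =
        fun i : I' => χ (Q.chartPlucker (hσ.mono hPQ) (i : ChartCoord).label) := by
      ext i
      rw [Function.comp_apply, hχ, hxτ i i.2]
    rw [e1, ← MvPolynomial.comp_aeval_apply, hf, map_zero]

end FlagMatroid

/-! ### The explicit coordinate systems -/

/-- The coordinates that generate if `p124 = 0` or `p3 = p13 = p23 = p34 = 0`. -/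
def coordsLeft (h : PluckerLabel → Prop) : Set ChartCoord := {i | match i with
  | x2 => h p2
  | x3 => h p3 ∧ ¬(h p13 ∧ ¬h p23) ∧ ¬(h p13 ∧ ¬h p34 ∧ h p14)
  | x4 => h p4
  | u3 => h p13
  | u4 => h p14 ∧ ¬(h p2 ∧ ¬h p24)
  | w4 => h p124}

/-- The coordinates that generate if `p2 = 0` or `p13 = p14 = p34 = p134 = 0`. -/
def coordsRight (h : PluckerLabel → Prop) : Set ChartCoord := {i | match i with
  | x2 => h p2
  | x3 => h p3 ∧ ¬(h p124 ∧ ¬h p234)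
  | x4 => h p4
  | u3 => h p13
  | u4 => h p14 ∧ ¬(h p13 ∧ ¬h p134) ∧ ¬(h p13 ∧ ¬h p34 ∧ h p3)
  | w4 => h p124}

/-- The coordinates that generate if `p13 = 0` and `p14` and `p3` are not. -/
def coordsMiddle (h : PluckerLabel → Prop) : Set ChartCoord := {i | match i with
  | x2 => h p2
  | x3 => h p3
  | x4 => h p4 ∧ ¬(h p2 ∧ h p14 ∧ ¬h p24)
  | u3 => h p13
  | u4 => h p14
  | w4 => h p124 ∧ h p234}

section Families

variable {h : PluckerLabel → Prop}

/-- If a coordinate of the chart vanishes identically, it lies in every subalgebra. -/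
theorem coord_mem_of_not {A : Type} [CommRing A] [Algebra ℂ A] {x : ChartCoord → A}
    (h0 : ∀ l, ¬ h l → plucker x l = 0) (L : Subalgebra ℂ A) (i : ChartCoord)
    (hi : h i.label → x i ∈ L) : x i ∈ L := by
  by_cases hl : h i.label
  · exact hi hl
  · rw [← plucker_label x i, h0 _ hl]
    exact L.zero_mem

/-- An omitted coordinate is zero or is solved from a vanishing two-term expression: `u4` from
`p24`, and then `x3` from `p23` or `p34`. -/
theorem mem_of_coordsLeft {A : Type} [CommRing A] [Algebra ℂ A] (x : ChartCoord → A)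
    (hu : ∀ l, h l → IsUnit (plucker x l)) (h0 : ∀ l, ¬ h l → plucker x l = 0)
    (L : Subalgebra ℂ A) (hL : L.InvClosed) (hI : ∀ i ∈ coordsLeft h, x i ∈ L) (i : ChartCoord) :
    x i ∈ L := by
  have m2 : x x2 ∈ L := coord_mem_of_not h0 L x2 (hI x2)
  have m4 : x x4 ∈ L := coord_mem_of_not h0 L x4 (hI x4)
  have m13 : x u3 ∈ L := coord_mem_of_not h0 L u3 (hI u3)
  have m124 : x w4 ∈ L := coord_mem_of_not h0 L w4 (hI w4)
  have m14 : x u4 ∈ L := coord_mem_of_not h0 L u4 fun h14 => by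
    by_cases hc : h p2 ∧ ¬h p24
    · have e := h0 _ hc.2
      simp only [plucker, sub_eq_zero] at e
      exact hL.mem_of_mul_mem m2 (hu p2 hc.1) (by rwa [e])
    · exact hI u4 ⟨h14, hc⟩
  have m3 : x x3 ∈ L := coord_mem_of_not h0 L x3 fun h3 => by
    by_cases hc : h p13 ∧ ¬h p23
    · have e := h0 _ hc.2
      simp only [plucker, sub_eq_zero] at e
      exact e ▸ L.mul_mem m2 m13
    by_cases hc' : h p13 ∧ ¬h p34 ∧ h p14
    · have e := h0 _ hc'.2.1
      simp only [plucker, sub_eq_zero] at e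
      exact hL.mem_of_mul_mem m14 (hu p14 hc'.2.2) (by rw [mul_comm, e]; exact L.mul_mem m4 m13)
    · exact hI x3 ⟨h3, hc, hc'⟩
  cases i <;> assumption

theorem mem_of_coordsRight {A : Type} [CommRing A] [Algebra ℂ A] (hh : ¬ h p2 ∨ ¬ h p134 ∧ ¬h p13)
    (x : ChartCoord → A)
    (hu : ∀ l, h l → IsUnit (plucker x l)) (h0 : ∀ l, ¬ h l → plucker x l = 0)
    (L : Subalgebra ℂ A) (hL : L.InvClosed) (hI : ∀ i ∈ coordsRight h, x i ∈ L) (i : ChartCoord) :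
    x i ∈ L := by
  have m2 : x x2 ∈ L := coord_mem_of_not h0 L x2 (hI x2)
  have m4 : x x4 ∈ L := coord_mem_of_not h0 L x4 (hI x4)
  have m13 : x u3 ∈ L := coord_mem_of_not h0 L u3 (hI u3)
  have m124 : x w4 ∈ L := coord_mem_of_not h0 L w4 (hI w4)
  -- This is `p2 * p134`. Without it `p234` reduces to `x4 - x3 * w4`, from which `x3` can be
  -- solved.
  have e2 : x x2 * (x u3 * x w4 - x u4) = 0 := by
    rcases hh with hh | hh
    · rw [show x x2 = 0 from h0 _ hh, zero_mul]
    · rw [show x u3 * x w4 - x u4 = 0 from h0 _ hh.1, mul_zero]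
  have m3 : x x3 ∈ L := coord_mem_of_not h0 L x3 fun h3 => by
    by_cases hc : h p124 ∧ ¬h p234
    · have e := h0 _ hc.2
      simp only [plucker] at e
      refine hL.mem_of_mul_mem m124 (hu p124 hc.1) ?_
      rw [show x w4 * x x3 = x x4 by linear_combination e2 - e]
      exact m4
    · exact hI x3 ⟨h3, hc⟩
  have m14 : x u4 ∈ L := coord_mem_of_not h0 L u4 fun h14 => by
    by_cases hc : h p13 ∧ ¬h p134
    · have e := h0 _ hc.2
      simp only [plucker, sub_eq_zero] at e
      exact e ▸ L.mul_mem m13 m124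
    by_cases hc' : h p13 ∧ ¬h p34 ∧ h p3
    · have e := h0 _ hc'.2.1
      simp only [plucker, sub_eq_zero] at e
      exact hL.mem_of_mul_mem m3 (hu p3 hc'.2.2) (by rw [e]; exact L.mul_mem m4 m13)
    · exact hI u4 ⟨h14, hc, hc'⟩
  cases i <;> assumption

/-- Here `x4` and `w4` are eliminated, by `p24` and `p234`, instead of `u4` and `x3`. In the
intended application `p3` and `p14` are bases of the face while `p4` and `p124` are not, so the
coordinates kept for the face remain available for the larger stratum. -/
theorem mem_of_coordsMiddle {A : Type} [CommRing A] [Algebra ℂ A] (h3 : h p3) (h13 : ¬ h p13)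
    (x : ChartCoord → A)
    (hu : ∀ l, h l → IsUnit (plucker x l)) (h0 : ∀ l, ¬ h l → plucker x l = 0)
    (L : Subalgebra ℂ A) (hL : L.InvClosed) (hI : ∀ i ∈ coordsMiddle h, x i ∈ L)
    (i : ChartCoord) : x i ∈ L := by
  have m2 : x x2 ∈ L := coord_mem_of_not h0 L x2 (hI x2)
  have m3 : x x3 ∈ L := coord_mem_of_not h0 L x3 (hI x3)
  have m13 : x u3 ∈ L := coord_mem_of_not h0 L u3 (hI u3)
  have m14 : x u4 ∈ L := coord_mem_of_not h0 L u4 (hI u4)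
  have m4 : x x4 ∈ L := coord_mem_of_not h0 L x4 fun h4 => by
    by_cases hc : h p2 ∧ h p14 ∧ ¬h p24
    · have e := h0 _ hc.2.2
      simp only [plucker, sub_eq_zero] at e
      exact e ▸ L.mul_mem m2 m14
    · exact hI x4 ⟨h4, hc⟩
  have m124 : x w4 ∈ L := coord_mem_of_not h0 L w4 fun h124 => by
    by_cases hc : h p234
    · exact hI w4 ⟨h124, hc⟩
    · have e := h0 _ hc
      have e' : x u3 = 0 := h0 _ h13
      simp only [plucker, e'] at e
      refine hL.mem_of_mul_mem m3 (hu p3 h3) ?_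
      rw [show x x3 * x w4 = x x4 - x x2 * x u4 by linear_combination -e]
      exact L.sub_mem m4 (L.mul_mem m2 m14)
  cases i <;> assumption

/-- For `w4 = 0` one has `p134 = -p14` and `p234 = -p24`, so only the first two rows of the matrix
matter. -/
theorem IsFlagPattern.isCoordSystem_of_not_p124 (hh : IsFlagPattern h) (h124 : ¬ h p124) :
    IsCoordSystem h (coordsLeft h) where
  mem x hu h0 L hL hI := mem_of_coordsLeft x hu h0 L hL hI
  exists_of_isGeneric τ hτ := by
    obtain ⟨x, y, z, u, v, hx, hy, hz, hd, hu, hv, he, hf, ex, ey, ez, eu, ev⟩ :=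
      exists_two_rows hh.rel_p24 hh.rel_p23 hh.rel_p34 hh.rel_p34' (hτ.ne_zero x2) (hτ.ne_zero u4)
        (hτ.ne_zero x4) (hτ.ne_zero u3) (hτ.ne_zero x3) hτ.p24 hτ.p23 hτ.p34
    refine ⟨fun | .x2 => x | .x3 => v | .x4 => z | .u3 => u | .u4 => y | .w4 => 0, ?_, ?_⟩
    · have h1 := hh.rel_p134
      have h2 := hh.rel_line2
      simp only [NotExactlyOne, h124, false_and, and_false, false_or, false_imp_iff,
        true_and] at h1 h2
      intro l
      cases l
      case p1 => simp [plucker, hh.rel_p1]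
      case p12 => simp [plucker, hh.rel_p12]
      case p123 => simp [plucker, hh.rel_p123]
      case p124 => simp [plucker, h124]
      case p134 => simp only [plucker, mul_zero, zero_sub, neg_ne_zero, hy]; exact ⟨h1.1, h1.2⟩
      case p234 =>
        simp only [plucker, mul_zero, zero_sub, sub_zero]
        rw [show x * -y + z = -(x * y - z) by ring, neg_ne_zero, hd]
        exact ⟨h2.1, h2.2⟩
      all_goals assumption
    · intro i hi
      cases i
      case w4 => exact absurd hi h124
      all_goals revert hi; assumption

/-- For `x2 = 0` the expressions `p134, p234, p34` have, up to sign, the shape of `p23, p24, p34` in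
the case `w4 = 0`: `w4` plays the role of `x2`, and `x3` and `u4` are interchanged. -/
theorem IsFlagPattern.isCoordSystem_of_not_p2 (hh : IsFlagPattern h) (h2 : ¬ h p2) :
    IsCoordSystem h (coordsRight h) where
  mem x hu h0 L hL hI := mem_of_coordsRight (Or.inl h2) x hu h0 L hL hI
  exists_of_isGeneric τ hτ := by
    have r23 := hh.rel_p23
    have r24 := hh.rel_p24
    have q1 := hh.rel_quad_p4
    have q2 := hh.rel_quad_p234
    have q3 := hh.rel_quad_p3
    simp only [NotExactlyOne, h2, false_and, false_or, false_imp_iff, true_and]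
      at r23 r24 q1 q2 q3
    have e23 : h p3 ↔ h p23 := ⟨r23.1, r23.2⟩
    have e24 : h p4 ↔ h p24 := ⟨r24.1, r24.2⟩
    obtain ⟨x, y, z, u, v, hx, hy, hz, hd, hu, hv, he, hf, ex, ey, ez, eu, ev⟩ :=
      exists_two_rows (a := h p124) (b := h p3) (c := h p4) (d := h p234)
        ⟨fun h => (q3 h.symm).symm, fun h => (q1 h).imp_left And.symm,
          fun h => (q2 h).imp_left And.symm⟩
        hh.rel_p134 (show NotExactlyOne (h p14 ∧ h p3) (h p4 ∧ h p13) (h p34) by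
          rw [and_comm]; exact hh.rel_p34)
        (show NotExactlyOne (h p13 ∧ h p234) (h p3 ∧ h p134) (h p34) by
          rw [e23]; exact hh.rel_line3) (hτ.ne_zero w4) (hτ.ne_zero x3)
        (hτ.ne_zero x4) (hτ.ne_zero u3) (hτ.ne_zero u4) hτ.p234 hτ.p134
        (by rw [mul_comm]; exact hτ.p34)
    refine ⟨fun | .x2 => 0 | .x3 => y | .x4 => z | .u3 => u | .u4 => v | .w4 => x, ?_, ?_⟩
    · intro l
      cases l
      case p1 => simp [plucker, hh.rel_p1]
      case p12 => simp [plucker, hh.rel_p12]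
      case p123 => simp [plucker, hh.rel_p123]
      case p2 => simp [plucker, h2]
      case p23 => simp [plucker, ← e23, ← hy]
      case p24 => simp [plucker, ← e24, ← hz]
      case p34 => rw [← hf]; simp [plucker, mul_comm]
      case p134 => rw [← he]; simp [plucker, mul_comm]
      case p234 =>
        rw [← hd, ← neg_ne_zero]
        simp only [plucker]
        rw [show x * y - z = -(0 * (u * x - v) - y * x + z) by ring]
      all_goals assumption
    · intro i hi
      cases i
      case x2 => exact absurd hi h2
      all_goals revert hi; assumption

/-- With `x3 = u3 = 0` only the relation among `x2, u4, x4` remains, and `w4` is unconstrained up to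
being zero or not. -/
theorem IsFlagPattern.isCoordSystem_of_not_p3 (hh : IsFlagPattern h) (h3 : ¬ h p3)
    (h13 : ¬ h p13) (h23 : ¬ h p23) (h34 : ¬ h p34) : IsCoordSystem h (coordsLeft h) where
  mem x hu h0 L hL hI := mem_of_coordsLeft x hu h0 L hL hI
  exists_of_isGeneric τ hτ := by
    classical
    obtain ⟨x, y, z, hx, hy, hz, hd, ex, ey, ez, -, -, -⟩ := exists_three_term hh.rel_p24
      (hτ.ne_zero x2) (hτ.ne_zero u4) (hτ.ne_zero x4) hτ.p24
    refine ⟨fun | .x2 => x | .x3 => 0 | .x4 => z | .u3 => 0 | .u4 => y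
                | .w4 => if h p124 then τ w4 else 0, ?_, ?_⟩
    · have h1 := hh.rel_p134
      have h2 := hh.rel_line2
      simp only [NotExactlyOne, h13, h23, false_and, and_false, false_or, false_imp_iff,
        true_and] at h1 h2
      intro l
      cases l
      case p1 => simp [plucker, hh.rel_p1]
      case p12 => simp [plucker, hh.rel_p12]
      case p123 => simp [plucker, hh.rel_p123]
      case p3 | p13 | p23 | p34 => simp [plucker, h3, h13, h23, h34]
      case p124 => simp [plucker, hτ.ne_zero]
      case p134 => simp only [plucker, zero_mul, zero_sub, neg_ne_zero, hy]; exact ⟨h1.1, h1.2⟩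
      case p234 =>
        simp only [plucker, zero_mul, zero_sub, sub_zero]
        rw [show x * -y + z = -(x * y - z) by ring, neg_ne_zero, hd]
        exact ⟨h2.1, h2.2⟩
      all_goals assumption
    · intro i hi
      cases i
      case x3 => exact absurd hi.1 h3
      case u3 => exact absurd hi h13
      case w4 => exact if_pos hi
      all_goals revert hi; assumption

/-- With `u3 = u4 = 0` only the relation among `w4, x3, x4` remains, and `x2` is unconstrained up to
being zero or not. -/
theorem IsFlagPattern.isCoordSystem_of_not_p134 (hh : IsFlagPattern h) (h13 : ¬ h p13)
    (h14 : ¬ h p14) (h34 : ¬ h p34) (h134 : ¬ h p134) : IsCoordSystem h (coordsRight h) where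
  mem x hu h0 L hL hI := mem_of_coordsRight (Or.inr ⟨h134, h13⟩) x hu h0 L hL hI
  exists_of_isGeneric τ hτ := by
    classical
    have r23 := hh.rel_p23
    have r24 := hh.rel_p24
    have q1 := hh.rel_quad_p4
    have q2 := hh.rel_quad_p234
    have q3 := hh.rel_quad_p3
    simp only [NotExactlyOne, h13, h14, h134, and_false, false_or, false_imp_iff, true_and]
      at r23 r24 q1 q2 q3
    have e23 : h p3 ↔ h p23 := ⟨r23.1, r23.2⟩
    have e24 : h p4 ↔ h p24 := ⟨r24.1, r24.2⟩
    obtain ⟨x, y, z, hx, hy, hz, hd, ex, ey, ez, -, -, -⟩ :=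
      exists_three_term (a := h p124) (b := h p3) (c := h p4) (d := h p234)
        ⟨fun h => (q3 h.symm).symm, fun h => (q1 h).imp_left And.symm,
          fun h => (q2 h).imp_left And.symm⟩
      (hτ.ne_zero w4) (hτ.ne_zero x3) (hτ.ne_zero x4) hτ.p234
    refine ⟨fun | .x2 => if h p2 then τ x2 else 0 | .x3 => y | .x4 => z | .u3 => 0 | .u4 => 0
                | .w4 => x, ?_, ?_⟩
    · intro l
      cases l
      case p1 => simp [plucker, hh.rel_p1]
      case p12 => simp [plucker, hh.rel_p12]
      case p123 => simp [plucker, hh.rel_p123]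
      case p2 => simp [plucker, hτ.ne_zero]
      case p13 | p14 | p34 | p134 => simp [plucker, h13, h14, h34, h134]
      case p23 => simp [plucker, ← e23, ← hy]
      case p24 => simp [plucker, ← e24, ← hz]
      case p234 =>
        rw [← hd, ← neg_ne_zero]
        simp only [plucker, zero_mul, sub_zero, mul_zero, zero_sub]
        rw [show x * y - z = -(-(y * x) + z) by ring]
      all_goals assumption
    · intro i hi
      cases i
      case x2 => exact if_pos hi
      case u3 => exact absurd hi h13
      case u4 => exact absurd hi.1 h14
      all_goals revert hi; assumption

theorem IsFlagPattern.isCoordSystem_of_not_p13 (hh : IsFlagPattern h) (h13 : ¬ h p13)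
    (h3 : h p3) (h14 : h p14) (h23 : h p23) (h34 : h p34) (h134 : h p134) :
    IsCoordSystem h (coordsMiddle h) where
  mem x hu h0 L hL hI := mem_of_coordsMiddle h3 h13 x hu h0 L hL hI
  exists_of_isGeneric τ hτ := by
    have h2 := hh.rel_line2
    simp only [NotExactlyOne, h23, true_and] at h2
    obtain ⟨x, y, z, hx, hy, hz, hd, ex, ey, ez, gx, gy, gz⟩ := exists_three_term' hh.rel_p24
      (hτ.ne_zero x2) (hτ.ne_zero u4) (hτ.ne_zero x4) hτ.p24
    have hy0 : y ≠ 0 := hy.mpr h14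
    have hyτ : y = τ u4 := ey h14
    have hτ3 := hτ.ne_zero x3
    -- For `u3 = 0` the coordinate `p234` is `-(x2 * u4 - x4 + x3 * w4)`; as `x3 ≠ 0`, its vanishing
    -- determines `w4`.
    obtain ⟨w, hw1, hw2, hw3⟩ : ∃ w : ℂ, (w ≠ 0 ↔ h p124) ∧ (x * y - z + τ x3 * w ≠ 0 ↔ h p234) ∧
        (h p124 ∧ h p234 → w = τ w4) := by
      by_cases h124 : h p124
      · by_cases h234 : h p234
        · refine ⟨τ w4, by simp [h124, hτ.ne_zero], ?_, fun _ => rfl⟩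
          have hτ4 := hτ.ne_zero w4
          have hs : x * y - z + τ x3 * τ w4 ≠ 0 := by
            rcases gz with gz | gz | gz
            · rcases gx with gx | gx
              · rw [gx, gz]; simp [hτ3, hτ4]
              · rw [gx, gz, hyτ, sub_zero]; exact hτ.sum'
            · rcases gx with gx | gx
              · rw [gx, gz, zero_mul, zero_sub, neg_add_eq_sub, mul_comm]; exact hτ.p234
              · rw [gx, gz, hyτ]; exact hτ.sum
            · rw [gz, sub_self, zero_add]; exact mul_ne_zero hτ3 hτ4
          exact ⟨fun _ => h234, fun _ => hs⟩
        · have hd' : x * y - z ≠ 0 := hd.mpr ((h2.1 h124).resolve_right h234)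
          refine ⟨-(x * y - z) / τ x3, ?_, ?_, by simp [h234]⟩
          · exact ⟨fun _ => h124, fun _ => div_ne_zero (neg_ne_zero.mpr hd') hτ3⟩
          · rw [mul_div_cancel₀ _ hτ3, add_neg_cancel]
            simp [h234]
      · refine ⟨0, by simp [h124], ?_, by simp [h124]⟩
        rw [mul_zero, add_zero, hd]
        exact ⟨fun h => (h2.2.1 h).resolve_left h124, fun h => (h2.2.2 h).resolve_left h124⟩
    refine ⟨fun | .x2 => x | .x3 => τ x3 | .x4 => z | .u3 => 0 | .u4 => y | .w4 => w, ?_, ?_⟩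
    · intro l
      cases l
      case p1 => simp [plucker, hh.rel_p1]
      case p12 => simp [plucker, hh.rel_p12]
      case p123 => simp [plucker, hh.rel_p123]
      case p3 => simp [plucker, h3, hτ3]
      case p13 => simp [plucker, h13]
      case p23 => simp [plucker, h23, hτ3]
      case p34 => simp [plucker, h34, hτ3, hy0]
      case p134 => simp [plucker, h134, hy0]
      case p234 =>
        rw [← hw2, ← neg_ne_zero]
        simp only [plucker]
        rw [show x * y - z + τ x3 * w = -(x * (0 * w - y) - τ x3 * w + z) by ring]
      all_goals assumption
    · intro i hi
      cases i
      case x3 => rfl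
      case u3 => exact absurd hi h13
      all_goals revert hi; assumption

end Families

/-! ### Basis exchange and internal flag matroids -/

/-- A linear form that attains its maximum over `s` at a point of the intrinsic interior is constant
on `s`. -/
theorem eq_of_mem_intrinsicInterior {E : Type*} [NormedAddCommGroup E] [NormedSpace ℝ E] {s : Set E}
    {x z : E} (hx : x ∈ intrinsicInterior ℝ s) (hz : z ∈ s) (f : E →ₗ[ℝ] ℝ)
    (hf : ∀ y ∈ s, f y ≤ f x) : f z = f x := by
  obtain ⟨y, hy, rfl⟩ := mem_intrinsicInterior.mp hx
  refine le_antisymm (hf z hz) (not_lt.mp fun hlt => ?_)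
  let z' : affineSpan ℝ s := ⟨z, subset_affineSpan ℝ s hz⟩
  have : Nonempty (affineSpan ℝ s) := ⟨y⟩
  have hc : Continuous fun t : ℝ => AffineMap.lineMap y z' t := AffineMap.lineMap_continuous
  -- On the line from `z` through `x`, points slightly beyond `x` still belong to `s`; if `f z < f
  -- x`, then `f` exceeds its maximum there.
  have h0 : ∀ᶠ t : ℝ in nhds 0, AffineMap.lineMap y z' t ∈ interior ((↑) ⁻¹' s : Set (affineSpan ℝ s)) :=
    hc.continuousAt.eventually_mem (isOpen_interior.mem_nhds (by simpa using hy))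
  obtain ⟨ε, hε, hball⟩ := Metric.eventually_nhds_iff.mp h0
  have h1 := interior_subset (hball (y := -(ε / 2)) (by
    rw [Real.dist_eq, sub_zero, abs_neg, abs_of_pos (half_pos hε)]; exact half_lt_self hε))
  have h2 := hf _ h1
  have h3 : ((AffineMap.lineMap y z' (-(ε / 2)) : affineSpan ℝ s) : E) =
      (y : E) + (-(ε / 2)) • (z - y) := by
    rw [AffineMap.lineMap_apply]
    simp [z', add_comm]
  rw [h3, map_add, map_smul, map_sub, smul_eq_mul] at h2
  nlinarith

namespace FlagMatroid

section Exchange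

variable {n s : ℕ} {r : Fin s → ℕ}

/-- The exchange property for a matroid and a quotient of it. -/
theorem exchange (Q : FlagMatroid n r) {i j : Fin s} (hij : i ≤ j) {b c : Finset (Fin n)}
    (hb : b ∈ Q.bases i) (hc : c ∈ Q.bases j) {e : Fin n} (he : e ∈ b) (he' : e ∉ c) :
    ∃ f ∈ c, f ∉ b ∧ insert f (b.erase e) ∈ Q.bases i ∧ insert e (c.erase f) ∈ Q.bases j := by
  classical
  have hE : ∀ k x, x ∈ (Q.matroid k).E := fun k x => by rw [Q.ground_eq]; trivial
  have hE' : ∀ k (X : Set (Fin n)), X ⊆ (Q.matroid k).E := fun k x => by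
    rw [Q.ground_eq]; exact Set.subset_univ _
  have hb' : (Q.matroid i).IsBase (b : Set (Fin n)) := hb
  have hc' : (Q.matroid j).IsBase (c : Set (Fin n)) := hc
  -- A flat of `Qᵢ` avoiding `e`, which by the quotient condition is also a flat of `Qⱼ`. The
  -- fundamental circuit of `e` in `c` therefore has another element outside `H`, and this element
  -- can be exchanged in both bases.
  let H := (Q.matroid i).closure ((b : Set (Fin n)) \ {e})
  have hHi : (Q.matroid i).IsFlat H := Matroid.isFlat_closure _
  have hHj : (Q.matroid j).IsFlat H := Q.isFlat_of_le i j hij H hHi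
  have heH : e ∉ H := hb'.indep.notMem_closure_sdiff_of_mem he
  have hC := hc'.fundCircuit_isCircuit (hE j e) he'
  obtain ⟨f, hfC, hfH⟩ : ∃ f ∈ (Q.matroid j).fundCircuit e c \ {e}, f ∉ H := by
    by_contra! hsub
    have h1 := hC.mem_closure_sdiff_singleton_of_mem ((Q.matroid j).mem_fundCircuit e c)
    have h2 := (Q.matroid j).closure_subset_closure (show _ ⊆ H from hsub) h1
    rw [hHj.closure] at h2
    exact heH h2
  have hfc : f ∈ (c : Set (Fin n)) := by
    have := (Q.matroid j).fundCircuit_subset_insert e c hfC.1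
    exact (Set.mem_insert_iff.mp this).resolve_left hfC.2
  have hfb : f ∉ b := fun h => hfH ((Q.matroid i).mem_closure_of_mem (show f ∈ (b : Set (Fin n)) \ {e}
    from ⟨h, hfC.2⟩) (hE' i _))
  refine ⟨f, hfc, hfb, ?_, ?_⟩
  · have := hb'.exchange_base_of_notMem_closure he hfH (hE i f)
    simpa [bases] using this
  · have h1 := (hc'.indep.mem_fundCircuit_iff (by rw [hc'.closure_eq]; exact hE j e) he').mp hfC.1
    have hfe : e ≠ f := fun h => hfC.2 h.symm
    rw [← Set.insert_sdiff_singleton_comm hfe] at h1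
    have := hc'.exchange_isBase_of_indep he' h1
    simpa [bases] using this

/-- Any exchange would produce a second basis of the `i`-th constituent, so every basis of every
constituent is contained in `S` or contains it. -/
theorem card_inter_of_bases_eq_singleton (P : FlagMatroid n r) {i : Fin s} {S : Finset (Fin n)}
    (hS : P.bases i = {S}) {j : Fin s} {b : Finset (Fin n)} (hb : b ∈ P.bases j) :
    (b ∩ S).card = min (r j) (r i) := by
  have hSi : S ∈ P.bases i := by rw [hS]; rfl
  have hcS := P.card_of_mem_bases hSi
  have hcb := P.card_of_mem_bases hb
  have hsub : b ⊆ S ∨ S ⊆ b := by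
    rcases le_total j i with hji | hij
    · left
      intro e he
      by_contra heS
      obtain ⟨f, hf, -, -, h⟩ := P.exchange hji hb hSi he heS
      rw [hS, Set.mem_singleton_iff] at h
      exact heS (h ▸ Finset.mem_insert_self _ _)
    · right
      intro e he
      by_contra heb
      obtain ⟨f, -, hf, h, -⟩ := P.exchange hij hSi hb he heb
      rw [hS, Set.mem_singleton_iff] at h
      exact hf (h ▸ Finset.mem_insert_self _ _)
  rcases hsub with h | h
  · rw [Finset.inter_eq_left.mpr h, hcb, min_eq_left]
    rw [← hcb, ← hcS]; exact Finset.card_le_card h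
  · rw [Finset.inter_eq_right.mpr h, hcS, min_eq_right]
    rw [← hcb, ← hcS]; exact Finset.card_le_card h

theorem sum_indicator_apply (S : Finset (Fin n)) (l : Fin s → Finset (Fin n)) :
    ∑ k ∈ S, (∑ i, fun k => if k ∈ l i then (1 : ℝ) else 0 : Fin n → ℝ) k =
      ∑ i, ((l i ∩ S).card : ℝ) := by
  simp only [Finset.sum_apply]
  rw [Finset.sum_comm]
  refine Finset.sum_congr rfl fun i _ => ?_
  rw [Finset.sum_boole, Finset.filter_mem_eq_inter, Finset.inter_comm]

/-- The constituents of an internal flag matroid have at least two bases. -/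
theorem IsInternal.exists_ne {P : FlagMatroid n r} (hP : P.IsInternal) {i : Fin s} (hi : 1 ≤ r i)
    (hi' : r i < n) (S : Finset (Fin n)) : ∃ b ∈ P.bases i, b ≠ S := by
  classical
  by_contra! hall
  obtain ⟨b₀, hb₀⟩ := P.bases_nonempty i
  have hS : P.bases i = {S} := Set.eq_singleton_iff_unique_mem.mpr
    ⟨hall b₀ hb₀ ▸ hb₀, hall⟩
  have hcS := P.card_of_mem_bases (show S ∈ P.bases i by rw [hS]; rfl)
  obtain ⟨x, hxP, hx⟩ := hP
  -- On `Δ(P)` this form is constantly equal to its upper bound `C` on `Δ(r, n)`; at a relative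
  -- interior point this forces it to be constant on all of `Δ(r, n)`.
  let f : (Fin n → ℝ) →ₗ[ℝ] ℝ := ∑ k ∈ S, LinearMap.proj k
  have hf : ∀ y, f y = ∑ k ∈ S, y k := fun y => by simp [f]
  let C : ℝ := ∑ j, (min (r j) (r i) : ℕ)
  have hfx : f x = C := by
    have : minkowskiPolytope P.bases ⊆ f ⁻¹' {C} := by
      refine convexHull_min ?_ ((convex_singleton C).linear_preimage f)
      rintro _ ⟨l, hl, rfl⟩
      rw [Set.mem_preimage, hf, sum_indicator_apply]
      simp only [P.card_inter_of_bases_eq_singleton hS (hl _)]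
      exact Set.mem_singleton _
    exact this hxP
  have hle : ∀ y ∈ uniformFlagPolytope n r, f y ≤ f x := by
    rw [hfx]
    have : uniformFlagPolytope n r ⊆ f ⁻¹' (Set.Iic C) := by
      refine convexHull_min ?_ ((convex_Iic C).linear_preimage f)
      rintro _ ⟨l, hl, rfl⟩
      rw [Set.mem_preimage, hf, sum_indicator_apply]
      refine Finset.sum_le_sum fun j _ => Nat.cast_le (α := ℝ).mpr (le_min ?_ ?_)
      · exact (Finset.card_le_card Finset.inter_subset_left).trans (hl j).le
      · exact (Finset.card_le_card Finset.inter_subset_right).trans hcS.le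
    exact fun y hy => this hy
  choose b hb using P.bases_nonempty
  obtain ⟨e, he⟩ : S.Nonempty := Finset.card_pos.mp (by omega)
  obtain ⟨g, hg⟩ : ∃ g, g ∉ S := by
    by_contra! h
    have := Finset.card_le_card (show Finset.univ ⊆ S from fun g _ => h g)
    simp at this
    omega
  -- Using `T` in the `i`-th place gives a point of `Δ(r, n)` at which the form is smaller than `C`.
  let T := insert g (S.erase e)
  have hT : T.card = r i := by
    rw [Finset.card_insert_of_notMem (fun h => hg (Finset.mem_of_mem_erase h)),
      Finset.card_erase_of_mem he]
    omega
  have hTS : (T ∩ S).card < r i := by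
    rw [← hcS]
    refine Finset.card_lt_card ⟨Finset.inter_subset_right, fun h => ?_⟩
    have := Finset.mem_inter.mp (h he)
    have h1 : e ∈ T := this.1
    rcases Finset.mem_insert.mp h1 with rfl | h2
    · exact hg he
    · exact Finset.notMem_erase _ _ h2
  let l : Fin s → Finset (Fin n) := Function.update b i T
  have hl : ∀ j, (l j).card = r j := fun j => by
    by_cases h : j = i
    · subst h; simp [l, hT]
    · simp [l, h, P.card_of_mem_bases (hb j)]
  have hz := eq_of_mem_intrinsicInterior hx (subset_convexHull ℝ _ ⟨l, hl, rfl⟩) f hle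
  rw [hfx, hf, sum_indicator_apply] at hz
  have hlt : ∑ j, ((l j ∩ S).card : ℝ) < ∑ j, ((min (r j) (r i) : ℕ) : ℝ) := by
    refine Finset.sum_lt_sum (fun j _ => Nat.cast_le (α := ℝ).mpr (le_min ?_ ?_))
      ⟨i, Finset.mem_univ _, Nat.cast_lt (α := ℝ).mpr ?_⟩
    · exact (Finset.card_le_card Finset.inter_subset_left).trans (hl j).le
    · exact (Finset.card_le_card Finset.inter_subset_right).trans hcS.le
    · simpa [l] using hTS
  exact hlt.ne hz

theorem ext_bases {P Q : FlagMatroid n r} (h : ∀ i, P.bases i = Q.bases i) : P = Q := by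
  have : P.matroid = Q.matroid := by
    funext i
    refine Matroid.ext_isBase (by rw [P.ground_eq, Q.ground_eq]) fun B _ => ?_
    have h1 := Set.ext_iff.mp (h i) (Set.toFinite B).toFinset
    simpa [bases] using h1
  cases P
  cases Q
  cases this
  rfl

end Exchange

end FlagMatroid

/-! ### The case distinction by the weight vector -/

/-- The excess of the weight of a label over that of the standard flag, for the weight vector
`(0, b, c, d)`. -/
def PluckerLabel.excess (b c d : ℝ) : PluckerLabel → ℝ
  | p1 => 0
  | p2 => b
  | p3 => c
  | p4 => d
  | p12 => 0
  | p13 => c - b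
  | p14 => d - b
  | p23 => c
  | p24 => d
  | p34 => c + d - b
  | p123 => 0
  | p124 => d - c
  | p134 => d - b
  | p234 => d

open PluckerLabel

/-- If `p` is the pattern of a face of a flag matroid with pattern `q`, and the constituents of the
face have at least two bases, then both patterns coincide or have compatible coordinate systems. -/
theorem IsFlagPattern.exists_isCoordSystem {p q : PluckerLabel → Prop} (hp : IsFlagPattern p)
    (hq : IsFlagPattern q) (b c d : ℝ) (hnn : ∀ l, q l → 0 ≤ excess b c d l)
    (hpq : ∀ l, p l ↔ q l ∧ excess b c d l = 0)
    (hne : ∀ l, ∃ m, m ≠ l ∧ m.level = l.level ∧ p m) :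
    p = q ∨ ∃ I I', I ⊆ I' ∧ IsCoordSystem p I ∧ IsCoordSystem q I' := by
  have hlt : ∀ l, excess b c d l < 0 → ¬ q l := fun l hl h => hl.not_ge (hnn l h)
  have hpne : ∀ l, excess b c d l ≠ 0 → ¬ p l := fun l hl h => hl ((hpq l).mp h).2
  have hmono : ∀ l, p l → q l := fun l h => ((hpq l).mp h).1
  have heq : ∀ l, p l → excess b c d l = 0 := fun l h => ((hpq l).mp h).2
  have hback : ∀ l, q l → excess b c d l = 0 → p l := fun l h h' => (hpq l).mpr ⟨h, h'⟩
  have n2 : b ≠ 0 → ¬ p p2 := hpne p2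
  have n3 : c ≠ 0 → ¬ p p3 := hpne p3
  have n13 : c - b ≠ 0 → ¬ p p13 := hpne p13
  have n14 : d - b ≠ 0 → ¬ p p14 := hpne p14
  have n23 : c ≠ 0 → ¬ p p23 := hpne p23
  have n34 : c + d - b ≠ 0 → ¬ p p34 := hpne p34
  have n124 : d - c ≠ 0 → ¬ p p124 := hpne p124
  have n134 : d - b ≠ 0 → ¬ p p134 := hpne p134
  have e2 : q p2 → b = 0 → p p2 := hback p2
  have e3 : q p3 → c = 0 → p p3 := hback p3
  have e4 : q p4 → d = 0 → p p4 := hback p4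
  have e13 : q p13 → c - b = 0 → p p13 := hback p13
  have e14 : q p14 → d - b = 0 → p p14 := hback p14
  have e23 : q p23 → c = 0 → p p23 := hback p23
  have e24 : q p24 → d = 0 → p p24 := hback p24
  have e34 : q p34 → c + d - b = 0 → p p34 := hback p34
  have e124 : q p124 → d - c = 0 → p p124 := hback p124
  have e134 : q p134 → d - b = 0 → p p134 := hback p134
  have e234 : q p234 → d = 0 → p p234 := hback p234
  -- Each constituent of the face has a basis outside the standard flag. Its excess is zero, which
  -- gives a linear condition on `b, c, d`.
  have i1 : d = 0 ∨ b = 0 ∧ p p2 ∨ c = 0 ∧ p p3 := by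
    obtain ⟨m, h1, h2, h3⟩ := hne p1
    cases m <;> simp [level] at h1 h2 <;> have := heq _ h3 <;> simp only [excess] at this <;> grind
  have i2 : c - b = 0 ∨ d - b = 0 ∨ c = 0 ∨ d = 0 ∨ c + d - b = 0 := by
    obtain ⟨m, h1, h2, h3⟩ := hne p12
    cases m <;> simp [level] at h1 h2 <;> have := heq _ h3 <;> simp only [excess] at this <;> grind
  have i3 : d = 0 ∨ d - b = 0 ∧ p p134 ∨ d - c = 0 ∧ p p124 := by
    obtain ⟨m, h1, h2, h3⟩ := hne p123
    cases m <;> simp [level] at h1 h2 <;> have := heq _ h3 <;> simp only [excess] at this <;> grind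
  -- In every branch but that of weight zero, labels of negative excess vanish for both patterns and
  -- select the coordinate system. The inclusion of the index sets holds because patterns agree on
  -- labels of excess zero, and the face has no others.
  rcases eq_or_ne d 0 with rfl | hd
  · rcases lt_trichotomy c 0 with hc | rfl | hc
    · by_cases hb : b < 0
      · right
        refine ⟨_, _, ?_, hp.isCoordSystem_of_not_p2 (hpne _ ?_),
          hq.isCoordSystem_of_not_p2 (hlt _ ?_)⟩
        · clear hne hpq hnn hlt hpne heq hback hp hq
          rintro (_ | _) <;> simp only [coordsRight, Set.mem_ofPred_eq] <;> grind
        all_goals simp only [excess]; grind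
      · right
        refine ⟨_, _, ?_, hp.isCoordSystem_of_not_p3 (hpne _ ?_) (hpne _ ?_) (hpne _ ?_) (hpne _ ?_),
          hq.isCoordSystem_of_not_p3 (hlt _ ?_) (hlt _ ?_) (hlt _ ?_) (hlt _ ?_)⟩
        · clear hne hpq hnn hlt hpne heq hback hp hq
          rintro (_ | _) <;> simp only [coordsLeft, Set.mem_ofPred_eq] <;> grind
        all_goals simp only [excess]; grind
    · rcases lt_trichotomy b 0 with hb | rfl | hb
      · right
        refine ⟨_, _, ?_, hp.isCoordSystem_of_not_p2 (hpne _ ?_),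
          hq.isCoordSystem_of_not_p2 (hlt _ ?_)⟩
        · clear hne hpq hnn hlt hpne heq hback hp hq
          rintro (_ | _) <;> simp only [coordsRight, Set.mem_ofPred_eq] <;> grind
        all_goals simp only [excess]; grind
      · left
        funext l
        refine propext ⟨hmono l, fun h => hback l h ?_⟩
        cases l <;> simp [excess]
      · right
        refine ⟨_, _, ?_, hp.isCoordSystem_of_not_p134 (hpne _ ?_) (hpne _ ?_) (hpne _ ?_)
            (hpne _ ?_),
          hq.isCoordSystem_of_not_p134 (hlt _ ?_) (hlt _ ?_) (hlt _ ?_) (hlt _ ?_)⟩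
        · clear hne hpq hnn hlt hpne heq hback hp hq
          rintro (_ | _) <;> simp only [coordsRight, Set.mem_ofPred_eq] <;> grind
        all_goals simp only [excess]; grind
    · right
      refine ⟨_, _, ?_, hp.isCoordSystem_of_not_p124 (hpne _ ?_),
        hq.isCoordSystem_of_not_p124 (hlt _ ?_)⟩
      · clear hne hpq hnn hlt hpne heq hback hp hq
        rintro (_ | _) <;> simp only [coordsLeft, Set.mem_ofPred_eq] <;> grind
      all_goals simp only [excess]; grind
  -- For `d ≠ 0`, `i1` and `i3` also allow `b = 0` and `c = d`, but then none of the alternatives in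
  -- `i2` holds.
  · obtain ⟨rfl, rfl⟩ : c = 0 ∧ b = d := by grind
    have h3 : p p3 := by grind
    have h134 : p p134 := by grind
    have h13 : ¬ p p13 := hpne p13 (by simpa [excess] using hd)
    have h4 : ¬ p p4 := hpne p4 (by simpa [excess] using hd)
    have h14 : p p14 := (hp.rel_p134.2.2 h134).resolve_left fun h => h13 h.2
    have h23 : p p23 := (hp.rel_p23.2.1 h3).resolve_left fun h => h13 h.2
    have h34 : p p34 := (hp.rel_p34.1 ⟨h3, h14⟩).resolve_left fun h => h13 h.2
    rcases hd.lt_or_gt with hd | hd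
    · right
      have h124 : ¬ q p124 := hlt p124 (by simpa [excess] using hd)
      refine ⟨_, _, ?_, hp.isCoordSystem_of_not_p2 (hpne _ ?_),
        hq.isCoordSystem_of_not_p2 (hlt _ ?_)⟩
      · clear hne hpq hnn hlt hpne heq hback hp hq
        rintro (_ | _) <;> simp only [coordsRight, Set.mem_ofPred_eq] <;> grind
      all_goals simp only [excess]; grind
    · right
      refine ⟨_, _, ?_, hp.isCoordSystem_of_not_p13 h13 h3 h14 h23 h34 h134,
        hq.isCoordSystem_of_not_p13 (hlt _ ?_) (hmono _ h3) (hmono _ h14) (hmono _ h23)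
          (hmono _ h34) (hmono _ h134)⟩
      · clear hne hpq hnn hlt hpne heq hback hp hq
        rintro (_ | _) <;> simp only [coordsMiddle, Set.mem_ofPred_eq] <;> grind
      all_goals simp only [excess]; grind

/-! ### From flag matroids to patterns, and conclusion -/

namespace PluckerLabel

/-- The set of columns of a label, counted from `0`. -/
def cols : PluckerLabel → Finset (Fin 4)
  | p1 => {0}
  | p2 => {1}
  | p3 => {2}
  | p4 => {3}
  | p12 => {0, 1}
  | p13 => {0, 2}
  | p14 => {0, 3}
  | p23 => {1, 2}
  | p24 => {1, 3}
  | p34 => {2, 3}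
  | p123 => {0, 1, 2}
  | p124 => {0, 1, 3}
  | p134 => {0, 2, 3}
  | p234 => {1, 2, 3}

theorem image_tuple (l : PluckerLabel) : Finset.univ.image l.tuple = l.cols := by
  cases l <;> decide

/-- The correction term depends only on the level, so weight and excess have the same minimizers in
each constituent. -/
theorem sum_cols (w : Fin 4 → ℝ) (l : PluckerLabel) : ∑ k ∈ l.cols, w k =
    excess (w 1 - w 0) (w 2 - w 0) (w 3 - w 0) l + ![w 0, w 0 + w 1, w 0 + w 1 + w 2] l.level := by
  cases l <;> simp [cols, level, excess]
  all_goals ring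

end PluckerLabel

namespace FlagMatroid

open PluckerLabel

variable (Q : FlagMatroid 4 ![1, 2, 3]) {σ : Equiv.Perm (Fin 4)}

theorem has_iff {l : PluckerLabel} : Q.Has σ l ↔ l.cols.image σ ∈ Q.bases l.level := by
  rw [← image_tuple, Finset.image_image]; rfl

theorem exists_label_of_mem_bases {i : Fin 3} {S : Finset (Fin 4)} (σ : Equiv.Perm (Fin 4))
    (hS : S ∈ Q.bases i) : ∃ l : PluckerLabel, l.level = i ∧ l.cols.image σ = S ∧ Q.Has σ l := by
  obtain ⟨l, rfl, h⟩ := exists_label_of_card σ i S (Q.card_of_mem_bases hS)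
  rw [← Finset.image_image, image_tuple] at h
  exact ⟨l, rfl, h, Q.has_iff.mpr (h ▸ hS)⟩

/-- The exchange property for labels, where `K` lists the possible outcomes. -/
theorem Has.exchange {Q : FlagMatroid 4 ![1, 2, 3]} {l m : PluckerLabel} (hl : Q.Has σ l)
    (hm : Q.Has σ m) (K : List (PluckerLabel × PluckerLabel)) (a : Fin 4)
    (hK : l.level ≤ m.level ∧ a ∈ l.cols ∧ a ∉ m.cols ∧ ∀ b ∈ m.cols, b ∉ l.cols →
      ∃ x ∈ K, x.1.level = l.level ∧ x.2.level = m.level ∧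
        x.1.cols = insert b (l.cols.erase a) ∧ x.2.cols = insert a (m.cols.erase b)) :
    ∃ x ∈ K, Q.Has σ x.1 ∧ Q.Has σ x.2 := by
  obtain ⟨hlm, ha, ha', hK⟩ := hK
  rw [has_iff] at hl hm
  obtain ⟨f, hf, hf', h1, h2⟩ := Q.exchange hlm hl hm (Finset.mem_image_of_mem σ ha)
    (by simpa using ha')
  obtain ⟨b, hb, rfl⟩ := Finset.mem_image.mp hf
  obtain ⟨x, hx, e1, e2, e3, e4⟩ := hK b hb (by simpa using hf')
  refine ⟨x, hx, ?_, ?_⟩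
  · rwa [has_iff, e1, e3, Finset.image_insert, Finset.image_erase σ.injective]
  · rwa [has_iff, e2, e4, Finset.image_insert, Finset.image_erase σ.injective]

/-- Each implication is a single exchange applied to the two labels of one term of a Plücker
relation; the possible outcomes are the other terms. Labels of the standard flag are always present,
so factors `p1`, `p12`, `p123` can be dropped. -/
theorem IsChart.isFlagPattern {Q : FlagMatroid 4 ![1, 2, 3]} (hσ : Q.IsChart σ) :
    IsFlagPattern (Q.Has σ) := by
  obtain ⟨h1, h12, h123⟩ := Q.isChart_iff.mp hσ
  refine ⟨h1, h12, h123, ⟨?_, ?_, ?_⟩, ⟨?_, ?_, ?_⟩, ⟨?_, ?_, ?_⟩, ⟨?_, ?_, ?_⟩, ⟨?_, ?_, ?_⟩,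
    ⟨?_, ?_, ?_⟩, ⟨?_, ?_, ?_⟩, ?_, ?_, ?_⟩
  · rintro ⟨h, h'⟩
    have := h.exchange h' [(p1, p23), (p3, p12)] 1 (by decide)
    simp only [List.mem_cons, List.not_mem_nil, or_false, exists_eq_or_imp, exists_eq_left] at this
    tauto
  · intro h
    have := h.exchange h12 [(p1, p23), (p2, p13)] 2 (by decide)
    simp only [List.mem_cons, List.not_mem_nil, or_false, exists_eq_or_imp, exists_eq_left] at this
    tauto
  · intro h
    have := h1.exchange h [(p2, p13), (p3, p12)] 0 (by decide)
    simp only [List.mem_cons, List.not_mem_nil, or_false, exists_eq_or_imp, exists_eq_left] at this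
    tauto
  · rintro ⟨h, h'⟩
    have := h.exchange h' [(p1, p24), (p4, p12)] 1 (by decide)
    simp only [List.mem_cons, List.not_mem_nil, or_false, exists_eq_or_imp, exists_eq_left] at this
    tauto
  · intro h
    have := h.exchange h12 [(p1, p24), (p2, p14)] 3 (by decide)
    simp only [List.mem_cons, List.not_mem_nil, or_false, exists_eq_or_imp, exists_eq_left] at this
    tauto
  · intro h
    have := h1.exchange h [(p2, p14), (p4, p12)] 0 (by decide)
    simp only [List.mem_cons, List.not_mem_nil, or_false, exists_eq_or_imp, exists_eq_left] at this
    tauto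
  · rintro ⟨h, h'⟩
    have := h.exchange h' [(p1, p34), (p4, p13)] 2 (by decide)
    simp only [List.mem_cons, List.not_mem_nil, or_false, exists_eq_or_imp, exists_eq_left] at this
    tauto
  · rintro ⟨h, h'⟩
    have := h.exchange h' [(p1, p34), (p3, p14)] 3 (by decide)
    simp only [List.mem_cons, List.not_mem_nil, or_false, exists_eq_or_imp, exists_eq_left] at this
    tauto
  · intro h
    have := h1.exchange h [(p3, p14), (p4, p13)] 0 (by decide)
    simp only [List.mem_cons, List.not_mem_nil, or_false, exists_eq_or_imp, exists_eq_left] at this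
    tauto
  · rintro ⟨h, h'⟩
    have := h.exchange h' [(p23, p14), (p34, p12)] 0 (by decide)
    simp only [List.mem_cons, List.not_mem_nil, or_false, exists_eq_or_imp, exists_eq_left] at this
    tauto
  · rintro ⟨h, h'⟩
    have := h.exchange h' [(p24, p13), (p34, p12)] 0 (by decide)
    simp only [List.mem_cons, List.not_mem_nil, or_false, exists_eq_or_imp, exists_eq_left] at this
    tauto
  · intro h
    have := h12.exchange h [(p23, p14), (p24, p13)] 0 (by decide)
    simp only [List.mem_cons, List.not_mem_nil, or_false, exists_eq_or_imp, exists_eq_left] at this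
    tauto
  · rintro ⟨h', h⟩
    have := h.exchange h' [(p12, p134), (p14, p123)] 2 (by decide)
    simp only [List.mem_cons, List.not_mem_nil, or_false, exists_eq_or_imp, exists_eq_left] at this
    tauto
  · intro h
    have := h.exchange h123 [(p12, p134), (p13, p124)] 3 (by decide)
    simp only [List.mem_cons, List.not_mem_nil, or_false, exists_eq_or_imp, exists_eq_left] at this
    tauto
  · intro h
    have := h12.exchange h [(p13, p124), (p14, p123)] 1 (by decide)
    simp only [List.mem_cons, List.not_mem_nil, or_false, exists_eq_or_imp, exists_eq_left] at this
    tauto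
  · rintro ⟨h, h'⟩
    have := h.exchange h' [(p12, p234), (p24, p123)] 2 (by decide)
    simp only [List.mem_cons, List.not_mem_nil, or_false, exists_eq_or_imp, exists_eq_left] at this
    tauto
  · intro h
    have := h.exchange h123 [(p12, p234), (p23, p124)] 3 (by decide)
    simp only [List.mem_cons, List.not_mem_nil, or_false, exists_eq_or_imp, exists_eq_left] at this
    tauto
  · intro h
    have := h12.exchange h [(p23, p124), (p24, p123)] 0 (by decide)
    simp only [List.mem_cons, List.not_mem_nil, or_false, exists_eq_or_imp, exists_eq_left] at this
    tauto
  · rintro ⟨h, h'⟩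
    have := h.exchange h' [(p23, p134), (p34, p123)] 0 (by decide)
    simp only [List.mem_cons, List.not_mem_nil, or_false, exists_eq_or_imp, exists_eq_left] at this
    tauto
  · rintro ⟨h, h'⟩
    have := h.exchange h' [(p13, p234), (p34, p123)] 1 (by decide)
    simp only [List.mem_cons, List.not_mem_nil, or_false, exists_eq_or_imp, exists_eq_left] at this
    tauto
  · intro h
    have := h.exchange h123 [(p13, p234), (p23, p134)] 3 (by decide)
    simp only [List.mem_cons, List.not_mem_nil, or_false, exists_eq_or_imp, exists_eq_left] at this
    tauto
  · intro h
    have := h.exchange h123 [(p1, p234), (p2, p134), (p3, p124)] 3 (by decide)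
    simp only [List.mem_cons, List.not_mem_nil, or_false, exists_eq_or_imp, exists_eq_left] at this
    tauto
  · intro h
    have := h1.exchange h [(p2, p134), (p3, p124), (p4, p123)] 0 (by decide)
    simp only [List.mem_cons, List.not_mem_nil, or_false, exists_eq_or_imp, exists_eq_left] at this
    tauto
  · rintro ⟨h, h'⟩
    have := h.exchange h' [(p1, p234), (p2, p134), (p4, p123)] 2 (by decide)
    simp only [List.mem_cons, List.not_mem_nil, or_false, exists_eq_or_imp, exists_eq_left] at this
    tauto

/-- Every basis contains a basis of each quotient. -/
theorem exists_bases_subset {n s : ℕ} {r : Fin s → ℕ} (Q : FlagMatroid n r) {i j : Fin s}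
    (hij : i ≤ j) {c : Finset (Fin n)} (hc : c ∈ Q.bases j) : ∃ b ∈ Q.bases i, b ⊆ c := by
  suffices H : ∀ k, ∀ b ∈ Q.bases i, (b \ c).card = k → ∃ b ∈ Q.bases i, b ⊆ c by
    obtain ⟨b, hb⟩ := Q.bases_nonempty i
    exact H _ b hb rfl
  intro k
  induction k with
  | zero =>
    intro b hb h
    exact ⟨b, hb, Finset.sdiff_eq_empty_iff_subset.mp (Finset.card_eq_zero.mp h)⟩
  | succ k ih =>
    intro b hb h
    obtain ⟨e, he⟩ : (b \ c).Nonempty := Finset.card_pos.mp (by omega)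
    obtain ⟨heb, hec⟩ := Finset.mem_sdiff.mp he
    -- Trading an element outside `c` for one inside lowers the number of elements of `b` outside
    -- `c`.
    obtain ⟨f, hf, -, h1, -⟩ := Q.exchange hij hb hc heb hec
    refine ih _ h1 ?_
    rw [Finset.insert_sdiff_of_mem _ hf, Finset.erase_sdiff_comm, Finset.card_erase_of_mem he, h]
    rfl

/-- Every flag matroid contains a flag of bases. -/
theorem exists_isChart : ∃ σ, Q.IsChart σ := by
  obtain ⟨S₃, h3⟩ := Q.bases_nonempty 2
  obtain ⟨S₂, h2, h23⟩ := Q.exists_bases_subset (show (1 : Fin 3) ≤ 2 by decide) h3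
  obtain ⟨S₁, h1, h12⟩ := Q.exists_bases_subset (show (0 : Fin 3) ≤ 1 by decide) h2
  have c1 : S₁.card = 1 := Q.card_of_mem_bases h1
  have c2 : S₂.card = 2 := Q.card_of_mem_bases h2
  have c3 : S₃.card = 3 := Q.card_of_mem_bases h3
  obtain ⟨x, rfl⟩ := Finset.card_eq_one.mp c1
  obtain ⟨y, hy⟩ := Finset.card_eq_one.mp (show (S₂ \ {x}).card = 1 by
    rw [Finset.card_sdiff_of_subset h12, c2, c1])
  obtain ⟨z, hz⟩ := Finset.card_eq_one.mp (show (S₃ \ S₂).card = 1 by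
    rw [Finset.card_sdiff_of_subset h23, c3, c2])
  obtain ⟨w, hw⟩ := Finset.card_eq_one.mp (show (S₃ᶜ).card = 1 by
    rw [Finset.card_compl, c3, Fintype.card_fin])
  have e2 : S₂ = {x, y} := by
    rw [← Finset.sdiff_union_of_subset h12, hy, Finset.union_comm]; rfl
  have e3 : S₃ = {x, y, z} := by
    rw [← Finset.sdiff_union_of_subset h23, hz, Finset.union_comm, e2]
    ext; simp
  have hyx : y ≠ x := by
    have := hy.ge (Finset.mem_singleton_self y)
    simpa using (Finset.mem_sdiff.mp this).2
  have hz' : z ∉ S₂ := (Finset.mem_sdiff.mp (hz.ge (Finset.mem_singleton_self z))).2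
  have hw' : w ∉ S₃ := Finset.mem_compl.mp (hw.ge (Finset.mem_singleton_self w))
  subst e2 e3
  have hinj : Function.Injective ![x, y, z, w] := by
    simp only [Finset.mem_insert, Finset.mem_singleton, not_or] at hz' hw'
    intro a b
    fin_cases a <;> fin_cases b <;> simp <;> grind
  refine ⟨Equiv.ofBijective _ (Finite.injective_iff_bijective.mp hinj), ?_⟩
  rw [isChart_iff, has_iff, has_iff, has_iff]
  refine ⟨?_, ?_, ?_⟩
  · simpa [cols, level] using h1
  · simpa [cols, level] using h2
  · simpa [cols, level] using h3

theorem IsFace.isSmoothConnected {P Q : FlagMatroid 4 ![1, 2, 3]} (hPQ : P.IsFace Q)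
    (hP : P.IsInternal) : (faceHom hPQ).toRingHom.IsSmoothConnected := by
  obtain ⟨v, hv⟩ := id hPQ
  obtain ⟨σ, hσ⟩ := P.exists_isChart
  obtain ⟨h1, h12, h123⟩ := P.isChart_iff.mp hσ
  let w : Fin 4 → ℝ := fun k => v (σ k)
  have hw : ∀ l : PluckerLabel, ∑ k ∈ l.cols.image σ, v k =
      excess (w 1 - w 0) (w 2 - w 0) (w 3 - w 0) l +
        ![w 0, w 0 + w 1, w 0 + w 1 + w 2] l.level := fun l => by
    rw [Finset.sum_image σ.injective.injOn, ← sum_cols]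
  -- The chart is chosen for the face, so the standard flag has minimal weight in every constituent
  -- and the minimal excess is zero.
  have hmin : ∀ l : PluckerLabel, ∃ m, P.Has σ m ∧ m.level = l.level ∧
      excess (w 1 - w 0) (w 2 - w 0) (w 3 - w 0) m = 0 := fun l => by
    rcases h : l.level with i
    fin_cases i
    · exact ⟨p1, h1, rfl, rfl⟩
    · exact ⟨p12, h12, rfl, rfl⟩
    · exact ⟨p123, h123, rfl, rfl⟩
  have hnn : ∀ l, Q.Has σ l → 0 ≤ excess (w 1 - w 0) (w 2 - w 0) (w 3 - w 0) l := by
    intro l hl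
    obtain ⟨m, hm, hml, hm0⟩ := hmin l
    rw [has_iff, hv] at hm
    rw [has_iff, ← hml] at hl
    have := hm.2 _ hl
    rw [hw, hw, hm0, hml] at this
    linarith
  have hiff : ∀ l, P.Has σ l ↔ Q.Has σ l ∧
      excess (w 1 - w 0) (w 2 - w 0) (w 3 - w 0) l = 0 := by
    intro l
    constructor
    · intro hl
      refine ⟨hl.mono hPQ, le_antisymm ?_ (hnn l (hl.mono hPQ))⟩
      obtain ⟨m, hm, hml, hm0⟩ := hmin l
      rw [has_iff, hv] at hl
      replace hm := hm.mono hPQ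
      rw [has_iff, hml] at hm
      have := hl.2 _ hm
      rw [hw, hw, hm0, hml] at this
      linarith
    · rintro ⟨hl, h0⟩
      rw [has_iff, hv]
      refine ⟨Q.has_iff.mp hl, fun c hc => ?_⟩
      obtain ⟨m, hml, rfl, hm⟩ := Q.exists_label_of_mem_bases σ hc
      have := hnn m hm
      rw [hw, hw, hml]
      linarith
  have hne : ∀ l : PluckerLabel, ∃ m, m ≠ l ∧ m.level = l.level ∧ P.Has σ m := by
    intro l
    obtain ⟨S, hS, hSl⟩ := hP.exists_ne (i := l.level) (by cases l <;> decide)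
      (by cases l <;> decide) (l.cols.image σ)
    obtain ⟨m, hml, rfl, hm⟩ := P.exists_label_of_mem_bases σ hS
    exact ⟨m, by rintro rfl; exact hSl rfl, hml, hm⟩
  rcases hσ.isFlagPattern.exists_isCoordSystem (hσ.mono hPQ).isFlagPattern _ _ _ hnn hiff hne with
    h | ⟨I, I', hI, hpI, hqI⟩
  · have hPQ' : P = Q := by
      refine ext_bases fun i => Set.ext fun S => ⟨fun hS => hPQ.mem_bases hS, fun hS => ?_⟩
      obtain ⟨l, rfl, rfl, hl⟩ := Q.exists_label_of_mem_bases σ hS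
      exact P.has_iff.mp (h ▸ hl)
    subst hPQ'
    have hid : faceHom hPQ = AlgHom.id ℂ P.coordRing := by
      have : faceHomR hPQ = AlgHom.id ℂ P.RRing := P.algHom_ext fun b => by
        rw [faceHomR_toRRing, inclB, MvPolynomial.rename_X]
        rfl
      ext f
      exact congrArg (fun g : P.RRing →ₐ[ℂ] P.RRing => g f) this
    rw [hid]
    exact .of_bijective Function.bijective_id
  · exact isSmoothConnected_faceHom hPQ hσ hI hpI hqI

end FlagMatroid

theorem mainTheorem6 (P Q : FlagMatroid 4 ![1, 2, 3]) (hQ : Q.polytopeDim = 3)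
    (hPQ : P.IsFace Q) (hP : P.IsInternal) :
    Smooth (FlagMatroid.faceMorphism hPQ) ∧
      IsDominant (FlagMatroid.faceMorphism hPQ) ∧
      ∀ y ∈ Set.range (FlagMatroid.faceMorphism hPQ),
        ConnectedSpace ((FlagMatroid.faceMorphism hPQ).fiber y) :=
  (hPQ.isSmoothConnected hP).spec
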